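/- Let $d\ge 1$ be an integer, $r=(r_1,\dots,r_d)\in\mathbb N^d$, $\sigma=(\sigma_1,\dots,\sigma_d)\in\prod_{l=1}^d(0,r_l+1)$, $0<p<\infty$ and $1\le q\le\infty$. Put $\underline\sigma=\min_l\sigma_l$, $H(\sigma)=\bigl(\frac1d\sum_{l=1}^d\frac1{\sigma_l}\bigr)^{-1}$, and assume $H(\sigma)/d>(1/p-1/q)_+$. Write $\|\cdot\|_u$ for the (quasi-)norm of $L_u([0,1]^d)$ with respect to Lebesgue measure ($\|\cdot\|_\infty$ being the essential supremum). A dyadic interval of generation $j\in\mathbb N$ is $[0,2^{-j}]$ or $(k2^{-j},(k+1)2^{-j}]$ with $k\in\{1,\dots,2^j-1\}$; a dyadic rectangle is a product of $d$ dyadic intervals. For $D\ge1$ let $\mathcal M_D$ be the set of partitions of $[0,1]^d$ into $D$ dyadic rectangles, and for $m\in\mathcal M_D$ let $S_{(m,r)}$ be the space of functions on $[0,1]^d$ which coincide on each rectangle of $m$ with a polynomial of degree $\le r_l$ in the $l$-th variable, $l=1,\dots,d$. For $k\in\mathbb N$ let $\Pi_k$ be the space of functions on $[0,1]^d$ which coincide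 with such a polynomial on each dyadic rectangle whose $l$-th side has generation $\lfloor k\underline\sigma/\sigma_l\rfloor$ for $l=1,\dots,d$. For $s\in L_p([0,1]^d)$ let $e_k(s)=\inf_{P\in\Pi_k}\|s-P\|_p$ and $$N_{p'}(s)=\Bigl(\sum_{k\in\mathbb N}\bigl(2^{k\underline\sigma}e_k(s)\bigr)^{p'}\Bigr)^{1/p'}\ (0<p'<\infty),\qquad N_\infty(s)=\sup_{k\in\mathbb N}2^{k\underline\sigma}e_k(s),$$ and $\mathcal S(r,\sigma,p,p',R)=\{s\in L_p([0,1]^d): N_{p'}(s)\le R\}$. Then there is a constant $C_2'>0$ depending only on $d,r,\sigma,p,q$ such that, for every $p'\in(0,\infty]$ (with $p'\le p$ in case $1<p<q$), every $R>0$ and every integer $D\ge 1$, $$\sup_{s\in\mathcal S(r,\sigma,p,p',R)}\ \inf_{t\in\bigcup_{m\in\mathcal M_D}S_{(m,r)}}\|s-t\|_q\ \le\ C_2'\,R\,D^{-H(\sigma)/d}.$$ -/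

import Mathlib

open MeasureTheory
open scoped ENNReal

noncomputable section

namespace DyadicApprox

/-- The unit cube `[0,1]^d`. -/
def unitCube (d : ℕ) : Set (Fin d → ℝ) := Set.Icc 0 1

/-- Lebesgue measure on the unit cube. -/
def cubeMeasure (d : ℕ) : Measure (Fin d → ℝ) := volume.restrict (unitCube d)

/-- The (quasi-)norm of `L_p([0,1]^d)`, `0 < p ≤ ∞` (essential supremum for `p = ∞`). -/
def cubeNorm {d : ℕ} (p : ℝ≥0∞) (f : (Fin d → ℝ) → ℝ) : ℝ≥0∞ := eLpNorm f p (cubeMeasure d)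

/-- The dyadic interval of generation `j` and position `k`:
`[0, 2^{-j}]` if `k = 0`, and `]k 2^{-j}, (k+1) 2^{-j}]` otherwise. -/
def dyadicInterval (j k : ℕ) : Set ℝ :=
  if k = 0 then Set.Icc 0 (1 / 2 ^ j) else Set.Ioc ((k : ℝ) / 2 ^ j) (((k : ℝ) + 1) / 2 ^ j)

/-- The dyadic rectangles of `[0,1]^d` of generation `j l` in each direction `l`. -/
def dyadicRectanglesOfGen {d : ℕ} (j : Fin d → ℕ) : Set (Set (Fin d → ℝ)) :=
  {K | ∃ k : Fin d → ℕ, (∀ l, k l < 2 ^ j l) ∧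
    K = Set.univ.pi fun l => dyadicInterval (j l) (k l)}

/-- The dyadic rectangles of `[0,1]^d`. -/
def dyadicRectangles (d : ℕ) : Set (Set (Fin d → ℝ)) :=
  {K | ∃ j : Fin d → ℕ, K ∈ dyadicRectanglesOfGen j}

/-- `𝓜_D`: the partitions of `[0,1]^d` into `D` dyadic rectangles. -/
def dyadicPartitions (d D : ℕ) : Set (Finset (Set (Fin d → ℝ))) :=
  {m | (∀ K ∈ m, K ∈ dyadicRectangles d) ∧
    (∀ K ∈ m, ∀ L ∈ m, K ≠ L → Disjoint K L) ∧
    (⋃ K ∈ m, K) = unitCube d ∧ m.card = D}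

/-- `𝒫_r`: the polynomials with degree `≤ r l` in each direction `l`. -/
def polys {d : ℕ} (r : Fin d → ℕ) : Set (MvPolynomial (Fin d) ℝ) :=
  {P | ∀ l, P.degreeOf l ≤ r l}

/-- The functions which coincide, on each set of the family `F`, with a polynomial with degree
`≤ r l` in each direction `l`. Only their values on `[0,1]^d` are used below. -/
def piecewisePolys {d : ℕ} (r : Fin d → ℕ) (F : Set (Set (Fin d → ℝ))) :
    Set ((Fin d → ℝ) → ℝ) :=
  {t | ∀ K ∈ F, ∃ P ∈ polys r, ∀ x ∈ K, t x = MvPolynomial.eval x P}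

/-- The minimum of `σ_1, …, σ_d` (for `d ≥ 1`). -/
def sigmaMin {d : ℕ} (σ : Fin d → ℝ) : ℝ := ⨅ l, σ l

/-- The harmonic mean `H(σ)` of `σ_1, …, σ_d`. -/
def harmonicMean {d : ℕ} (σ : Fin d → ℝ) : ℝ := (1 / (d : ℝ) * ∑ l, 1 / σ l)⁻¹

/-- `𝓓_k^σ`: the dyadic rectangles with sidelength `2^{-⌊k σ_min / σ_l⌋}` in each direction `l`. -/
def anisotropicRectangles {d : ℕ} (σ : Fin d → ℝ) (k : ℕ) : Set (Set (Fin d → ℝ)) :=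
  dyadicRectanglesOfGen fun l => ⌊(k : ℝ) * sigmaMin σ / σ l⌋₊

/-- `e_{r,σ,p,k}(s)`: the error of best `L_p`-approximation of `s` by functions which are
piecewise polynomial over `𝓓_k^σ`. -/
def approxError {d : ℕ} (r : Fin d → ℕ) (σ : Fin d → ℝ) (p : ℝ≥0∞) (k : ℕ)
    (s : (Fin d → ℝ) → ℝ) : ℝ≥0∞ :=
  ⨅ P ∈ piecewisePolys r (anisotropicRectangles σ k), cubeNorm p (s - P)

/-- The (quasi-)semi-norm `N_{r,σ,p,p'}`. -/
def smoothness {d : ℕ} (r : Fin d → ℕ) (σ : Fin d → ℝ) (p p' : ℝ≥0∞)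
    (s : (Fin d → ℝ) → ℝ) : ℝ≥0∞ :=
  if p' = ∞ then ⨆ k : ℕ, 2 ^ ((k : ℝ) * sigmaMin σ) * approxError r σ p k s
  else (∑' k : ℕ, (2 ^ ((k : ℝ) * sigmaMin σ) * approxError r σ p k s) ^ p'.toReal)
    ^ (1 / p'.toReal)

/-- The class `𝓢(r,σ,p,p',R)`. -/
def smoothnessClass {d : ℕ} (r : Fin d → ℕ) (σ : Fin d → ℝ) (p p' : ℝ≥0∞) (R : ℝ) :
    Set ((Fin d → ℝ) → ℝ) :=
  {s | MemLp s p (cubeMeasure d) ∧ smoothness r σ p p' s ≤ ENNReal.ofReal R}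

end DyadicApprox

end

/-! Only the decay of `e_k(s)` at rate `R 2^(-k σ_min)` matters, and since the cube has measure one,
`q` may be raised to `max p q`; so let `p ≤ q`, `δ = 1/p - 1/q` and `α = H(σ)/d > δ`. With `y =
2^(σ_min ∑ 1/σ_l)`, level `k` has at most `y^k` cells, and near-best piecewise polynomials `P_k`
have `L_p`-error of order `R y^(-αk)`.

Start at a level `k₀` with `y^k₀` comparable to `D`, and refine only where needed. A cell of level
`k₀ + k + 1` is selected if it carries more than a fraction `1/N_k` of the bound on the `p`-th power
integral of the increment of `P`; at most `N_k` cells qualify. Each point stops at the first level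
whose cell contains no selected cell. With `N_k = n ρ^k` and `n` a small multiple of `D`, at most
`D` terminal cells arise. On unselected cells Nikolskii's inequality turns the small integral into a
pointwise bound, and interpolation between `L_p` and `L_∞` gives the increment an `L_q`-norm of
order `R D^(-α) θ^k`. Since `α > δ`, `ρ` can be taken so close to 1 that `θ < 1`, and the series
converges.

The argument rests on `exists_adaptive_level` (selection and stopping), `exists_nikolskii`, and
`exists_partition_of_level` (from stopping levels to a partition); `exists_adaptive_approx` chooses
the parameters. -/

noncomputable section

namespace DyadicApprox

open Filter Topology

/-! ### Adaptive refinement in an abstract measure space. -/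

/-- Interpolation between `L_p` and `L_∞`. -/
lemma eLpNorm_le_of_ae_bound_of_eLpNorm_le {Ω : Type*} [MeasurableSpace Ω] {μ : Measure Ω}
    {p q : ℝ≥0∞} (hp0 : 0 < p) (hp : p < ∞) (hpq : p ≤ q) {f : Ω → ℝ} {B Z : ℝ}
    (hB : 0 < B) (hZ : 0 < Z)
    (hsup : ∀ᵐ x ∂μ, ‖f x‖ₑ ^ p.toReal ≤ ENNReal.ofReal (Z * B ^ p.toReal))
    (hf : eLpNorm f p μ ≤ ENNReal.ofReal B) :
    eLpNorm f q μ ≤ ENNReal.ofReal (B * Z ^ (p⁻¹.toReal - q⁻¹.toReal)) := by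
  have hpr : 0 < p.toReal := ENNReal.toReal_pos hp0.ne' hp.ne
  have hsup' : ∀ᵐ x ∂μ, ‖f x‖ₑ ≤ ENNReal.ofReal (B * Z ^ (p.toReal)⁻¹) := by
    filter_upwards [hsup] with x hx
    have h := ENNReal.rpow_le_rpow hx (inv_nonneg.2 hpr.le)
    rw [ENNReal.rpow_rpow_inv hpr.ne', ENNReal.ofReal_rpow_of_pos (by positivity)] at h
    refine h.trans_eq ?_
    rw [Real.mul_rpow hZ.le (by positivity), Real.rpow_rpow_inv hB.le hpr.ne', mul_comm]
  rcases eq_or_ne q ∞ with rfl | hq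
  · simp only [ENNReal.inv_top, ENNReal.toReal_zero, sub_zero, ENNReal.toReal_inv]
    rw [eLpNorm_exponent_top]
    exact eLpNormEssSup_le_of_ae_enorm_bound hsup'
  have hq0 : q ≠ 0 := (hp0.trans_le hpq).ne'
  have hqr : 0 < q.toReal := ENNReal.toReal_pos hq0 hq
  have hpqr : p.toReal ≤ q.toReal := ENNReal.toReal_mono hq hpq
  have hint : ∫⁻ x, ‖f x‖ₑ ^ p.toReal ∂μ ≤ ENNReal.ofReal (B ^ p.toReal) := by
    rw [eLpNorm_eq_lintegral_rpow_enorm_toReal hp0.ne' hp.ne] at hf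
    have h := ENNReal.rpow_le_rpow hf hpr.le
    rwa [one_div, ENNReal.rpow_inv_rpow hpr.ne', ENNReal.ofReal_rpow_of_pos hB] at h
  rw [eLpNorm_eq_lintegral_rpow_enorm_toReal hq0 hq, one_div,
    ENNReal.rpow_inv_le_iff hqr]
  calc ∫⁻ x, ‖f x‖ₑ ^ q.toReal ∂μ
      ≤ ∫⁻ x, ENNReal.ofReal ((B * Z ^ (p.toReal)⁻¹) ^ (q.toReal - p.toReal))
          * ‖f x‖ₑ ^ p.toReal ∂μ := by
        refine lintegral_mono_ae ?_
        filter_upwards [hsup'] with x hx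
        -- Split `|f|^q = |f|^(q-p) |f|^p`; the essential bound controls the first factor.
        have : q.toReal = (q.toReal - p.toReal) + p.toReal := by ring
        conv_lhs => rw [this]
        rw [ENNReal.rpow_add_of_nonneg _ _ (by linarith) hpr.le]
        gcongr
        rw [← ENNReal.ofReal_rpow_of_pos (by positivity)]
        exact ENNReal.rpow_le_rpow hx (by linarith)
    _ = ENNReal.ofReal ((B * Z ^ (p.toReal)⁻¹) ^ (q.toReal - p.toReal))
          * ∫⁻ x, ‖f x‖ₑ ^ p.toReal ∂μ := lintegral_const_mul' _ _ ENNReal.ofReal_ne_top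
    _ ≤ ENNReal.ofReal ((B * Z ^ (p.toReal)⁻¹) ^ (q.toReal - p.toReal))
          * ENNReal.ofReal (B ^ p.toReal) := by gcongr
    _ = ENNReal.ofReal (B * Z ^ (p⁻¹.toReal - q⁻¹.toReal)) ^ q.toReal := by
        rw [← ENNReal.ofReal_mul (by positivity), ENNReal.ofReal_rpow_of_pos (by positivity)]
        congr 1
        rw [Real.mul_rpow hB.le (by positivity), Real.mul_rpow hB.le (by positivity),
          ← Real.rpow_mul hZ.le, ← Real.rpow_mul hZ.le, mul_right_comm, ← Real.rpow_add hB,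
          ENNReal.toReal_inv, ENNReal.toReal_inv]
        congr 2
        · ring
        · field_simp

/-- Few cells of a finite measurable family can carry a large part of an integral. -/
lemma card_le_of_le_lintegral_fiber {Ω ι : Type*} [MeasurableSpace Ω] [MeasurableSpace ι]
    [MeasurableSingletonClass ι] {μ : Measure Ω} {g : Ω → ι} (hg : Measurable g)
    (f : Ω → ℝ≥0∞) {b N : ℝ} (hb : 0 < b) (hN : 0 < N)
    (hf : ∫⁻ x, f x ∂μ ≤ ENNReal.ofReal b) (L : Finset ι)
    (hL : ∀ i ∈ L, ENNReal.ofReal (b / N) ≤ ∫⁻ x in g ⁻¹' {i}, f x ∂μ) :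
    (L.card : ℝ) ≤ N := by
  have h1 : (L.card : ℝ≥0∞) * ENNReal.ofReal (b / N) ≤ ENNReal.ofReal b := by
    calc (L.card : ℝ≥0∞) * ENNReal.ofReal (b / N)
        = ∑ i ∈ L, ENNReal.ofReal (b / N) := by simp
      _ ≤ ∑ i ∈ L, ∫⁻ x in g ⁻¹' {i}, f x ∂μ := Finset.sum_le_sum hL
      _ = ∫⁻ x in ⋃ i ∈ L, g ⁻¹' {i}, f x ∂μ := by
          rw [lintegral_biUnion_finset]
          · intro i _ j _ hij
            exact Disjoint.preimage g (by simpa using hij)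
          · intro i _
            exact hg (measurableSet_singleton i)
      _ ≤ ∫⁻ x, f x ∂μ := setLIntegral_le_lintegral _ _
      _ ≤ _ := hf
  rw [← ENNReal.ofReal_natCast, ← ENNReal.ofReal_mul (by positivity),
    ENNReal.ofReal_le_ofReal_iff hb.le, mul_div_assoc', div_le_iff₀ hN, mul_comm] at h1
  exact le_of_mul_le_mul_left h1 hb

/-- Adaptive approximation by means of a nested sequence of partitions of a measure space: the cell
of `x` at level `k` is labelled by `idx k x`, and `P k` is the approximation at level `k`. -/
theorem exists_adaptive_level {Ω ι : Type*} [MeasurableSpace Ω] [MeasurableSpace ι]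
    [MeasurableSingletonClass ι] [Countable ι] [DecidableEq ι] {μ : Measure Ω}
    {p q : ℝ≥0∞} (hp0 : 0 < p) (hp : p < ∞) (hpq : p ≤ q) (hq : 1 ≤ q)
    {idx : ℕ → Ω → ι} (hidx : ∀ k, Measurable (idx k))
    {proj : ℕ → ℕ → ι → ι} (hproj : ∀ k k', k ≤ k' → ∀ x, proj k k' (idx k' x) = idx k x)
    {Q : Set Ω} (hQ : ∀ᵐ x ∂μ, x ∈ Q)
    {G : ℕ → Finset ι} (hG : ∀ k, ∀ x ∈ Q, idx k x ∈ G k)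
    {ch : ℕ → ι → Finset ι} (hch : ∀ k x, idx (k + 1) x ∈ ch k (idx k x))
    {b : ℕ} (hb : ∀ k i, (ch k i).card ≤ b)
    {P : ℕ → Ω → ℝ} (hP : ∀ k, Measurable (P k))
    {s : Ω → ℝ} (hs : AEStronglyMeasurable s μ)
    (hlim : Tendsto (fun k => eLpNorm (s - P k) p μ) atTop (𝓝 0))
    {B W N : ℕ → ℝ} (hB : ∀ k, 0 < B k) (hW : ∀ k, 0 < W k) (hN : ∀ k, 0 < N k)
    (hPB : ∀ k, eLpNorm (P (k + 1) - P k) p μ ≤ ENNReal.ofReal (B k))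
    (hNik : ∀ k, ∀ x ∈ Q, ‖P (k + 1) x - P k x‖ₑ ^ p.toReal ≤ ENNReal.ofReal (W k) *
      ∫⁻ y in idx (k + 1) ⁻¹' {idx (k + 1) x}, ‖P (k + 1) y - P k y‖ₑ ^ p.toReal ∂μ)
    (hN1 : ∃ M, ∀ k, M ≤ k → N k < 1) {S : ℝ}
    (hS : ∀ M, ∑ k ∈ Finset.range M, ((k : ℝ) + 1) * N k ≤ S) :
    ∃ (lev : Ω → ℕ) (F : Finset (ℕ × ι)),
      (∀ x y, idx (lev x) y = idx (lev x) x → lev y = lev x) ∧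
      (∀ x ∈ Q, (lev x, idx (lev x) x) ∈ F) ∧
      (F.card : ℝ) ≤ (G 0).card + b * S ∧
      eLpNorm (s - fun x => P (lev x) x) q μ ≤
        ∑' k, ENNReal.ofReal (B k * (W k / N k) ^ (p⁻¹.toReal - q⁻¹.toReal)) := by
  classical
  have hpr : 0 < p.toReal := ENNReal.toReal_pos hp0.ne' hp.ne
  obtain ⟨M, hM⟩ := hN1
  -- the selected cells of level `k + 1`
  let Sel : ℕ → Finset ι := fun k => (G (k + 1)).filter fun i =>
    ENNReal.ofReal (B k ^ p.toReal / N k) <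
      ∫⁻ y in idx (k + 1) ⁻¹' {i}, ‖P (k + 1) y - P k y‖ₑ ^ p.toReal ∂μ
  have hSelcard : ∀ k, ((Sel k).card : ℝ) ≤ N k := by
    intro k
    refine card_le_of_le_lintegral_fiber (μ := μ) (hidx (k + 1))
      (fun y => ‖P (k + 1) y - P k y‖ₑ ^ p.toReal) (b := B k ^ p.toReal)
      (Real.rpow_pos_of_pos (hB k) _) (hN k) ?_ _ ?_
    · have h := ENNReal.rpow_le_rpow (hPB k) hpr.le
      rwa [eLpNorm_eq_lintegral_rpow_enorm_toReal hp0.ne' hp.ne, one_div,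
        ENNReal.rpow_inv_rpow hpr.ne', ENNReal.ofReal_rpow_of_pos (hB k)] at h
    · intro i hi
      exact (Finset.mem_filter.1 hi).2.le
  -- A cardinality below one is zero, so selection ends after finitely many levels.
  have hSelempty : ∀ k, M ≤ k → Sel k = ∅ := by
    intro k hk
    have h := (hSelcard k).trans_lt (hM k hk)
    rw [← Finset.card_eq_zero]
    exact_mod_cast Nat.lt_one_iff.1 (by exact_mod_cast h)
  -- the cells of level `m` which contain a selected cell of higher level
  let X : ℕ → Finset ι := fun m =>
    (Finset.Ico m M).biUnion fun k => (Sel k).image (proj m (k + 1))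
  have hXempty : ∀ m, M ≤ m → X m = ∅ := by
    intro m hm
    simp [X, Finset.Ico_eq_empty_of_le hm]
  have hXcard : ∀ m, ((X m).card : ℝ) ≤ ∑ k ∈ Finset.Ico m M, N k := by
    intro m
    calc ((X m).card : ℝ) ≤ ((∑ k ∈ Finset.Ico m M, (Sel k).card : ℕ) : ℝ) := by
          exact_mod_cast Finset.card_biUnion_le.trans
            (Finset.sum_le_sum fun k _ => Finset.card_image_le)
      _ ≤ _ := by
          push_cast
          exact Finset.sum_le_sum fun k _ => hSelcard k
  have hex : ∀ x, ∃ m, idx m x ∉ X m := fun x => ⟨M, by simp [hXempty M le_rfl]⟩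
  let lev : Ω → ℕ := fun x => Nat.find (hex x)
  have hlev : ∀ x, idx (lev x) x ∉ X (lev x) := fun x => Nat.find_spec (hex x)
  have hlevmin : ∀ x m, m < lev x → idx m x ∈ X m := fun x m hm =>
    not_not.1 (Nat.find_min (hex x) hm)
  have hlevle : ∀ x, lev x ≤ M := fun x => Nat.find_le (by simp [hXempty M le_rfl])
  -- A selected cell around `x` beyond the stopping level would have the stopping cell of `x` as an
  -- ancestor.
  have hunsel : ∀ x k, lev x ≤ k → idx (k + 1) x ∉ Sel k := by
    intro x k hk hsel
    have hkM : k < M := by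
      by_contra h
      rw [hSelempty k (not_lt.1 h)] at hsel
      simp at hsel
    apply hlev x
    refine Finset.mem_biUnion.2 ⟨k, Finset.mem_Ico.2 ⟨hk, hkM⟩, ?_⟩
    exact Finset.mem_image.2 ⟨_, hsel, hproj _ _ (by omega) x⟩
  -- A terminal cell is initial, or a child of a cell in some `X m`, because its parent did not
  -- stop. `F` may contain further cells; only its size matters.
  let F : Finset (ℕ × ι) := (G 0).image (fun i => (0, i)) ∪
    (Finset.range M).biUnion fun m => (X m).biUnion fun i => (ch m i).image fun j => (m + 1, j)
  let t : Ω → ℝ := fun x => P (lev x) x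
  have hEmeas : ∀ k, MeasurableSet {x | lev x ≤ k} := by
    intro k
    have : {x | lev x ≤ k} = ⋃ m ∈ Finset.range (k + 1), (idx m) ⁻¹' (X m : Set ι)ᶜ := by
      ext x
      simp only [lev, Set.mem_ofPred_eq, Nat.find_le_iff, Set.mem_iUnion, Finset.mem_range,
        Set.mem_preimage, Set.mem_compl_iff, Finset.mem_coe, exists_prop, Nat.lt_succ_iff]
    rw [this]
    exact Finset.measurableSet_biUnion _ fun m _ => hidx m (X m).measurableSet.compl
  -- The increments beyond the stopping level; they telescope to `P K - t`.
  let D : ℕ → Ω → ℝ := fun k => Set.indicator {x | lev x ≤ k} (P (k + 1) - P k)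
  have hDmeas : ∀ k, Measurable (D k) := fun k =>
    ((hP (k + 1)).sub (hP k)).indicator (hEmeas k)
  have hDbound : ∀ k, eLpNorm (D k) q μ ≤
      ENNReal.ofReal (B k * (W k / N k) ^ (p⁻¹.toReal - q⁻¹.toReal)) := by
    intro k
    refine eLpNorm_le_of_ae_bound_of_eLpNorm_le hp0 hp hpq (hB k) (div_pos (hW k) (hN k)) ?_ ?_
    · filter_upwards [hQ] with x hx
      by_cases hk : lev x ≤ k
      · have h1 : D k x = P (k + 1) x - P k x := Set.indicator_of_mem (by exact hk) _
        rw [h1]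
        refine (hNik k x hx).trans ?_
        have h2 := hunsel x k hk
        have h3 : ∫⁻ y in idx (k + 1) ⁻¹' {idx (k + 1) x}, ‖P (k + 1) y - P k y‖ₑ ^ p.toReal ∂μ
            ≤ ENNReal.ofReal (B k ^ p.toReal / N k) := by
          by_contra h
          exact h2 (Finset.mem_filter.2 ⟨hG _ x hx, not_le.1 h⟩)
        calc _ ≤ ENNReal.ofReal (W k) * ENNReal.ofReal (B k ^ p.toReal / N k) := by gcongr
          _ = _ := by
            rw [← ENNReal.ofReal_mul (hW k).le]
            congr 1
            ring
      · have h1 : D k x = 0 := Set.indicator_of_notMem (by exact hk) _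
        rw [h1, enorm_zero, ENNReal.zero_rpow_of_pos hpr]
        exact zero_le
    · exact (eLpNorm_indicator_le _).trans (hPB k)
  have hsum : ∀ K, M ≤ K → P K - t = ∑ k ∈ Finset.range K, D k := by
    intro K hK
    funext x
    rw [Finset.sum_apply, Pi.sub_apply]
    have h1 : ∀ k ∈ Finset.range K, D k x = if lev x ≤ k then P (k + 1) x - P k x else 0 := by
      intro k _
      simp only [D, Set.indicator_apply, Set.mem_ofPred_eq, Pi.sub_apply]
    rw [Finset.sum_congr rfl h1, ← Finset.sum_filter]
    have h2 : (Finset.range K).filter (fun k => lev x ≤ k) = Finset.Ico (lev x) K := by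
      ext k
      simp only [Finset.mem_filter, Finset.mem_range, Finset.mem_Ico]
      exact and_comm
    rw [h2, Finset.sum_Ico_sub (fun k => P k x) ((hlevle x).trans hK)]
  have hPt : ∀ K, M ≤ K → AEStronglyMeasurable (P K - t) μ := by
    intro K hK
    rw [hsum K hK]
    exact Finset.aestronglyMeasurable_sum _ fun k _ => (hDmeas k).aestronglyMeasurable
  have hbound : ∀ K, M ≤ K → eLpNorm (P K - t) q μ ≤
      ∑' k, ENNReal.ofReal (B k * (W k / N k) ^ (p⁻¹.toReal - q⁻¹.toReal)) := by
    intro K hK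
    rw [hsum K hK]
    refine (eLpNorm_sum_le (fun k _ => (hDmeas k).aestronglyMeasurable) hq).trans ?_
    exact (Finset.sum_le_sum fun k _ => hDbound k).trans (ENNReal.sum_le_tsum _)
  refine ⟨lev, F, ?_, ?_, ?_, ?_⟩
  · intro x y hxy
    -- A common cell at level `lev x` forces common cells at all lower levels, hence the same
    -- stopping decisions.
    have hagree : ∀ m, m ≤ lev x → idx m y = idx m x := by
      intro m hm
      rw [← hproj m (lev x) hm y, ← hproj m (lev x) hm x, hxy]
    refine (Nat.find_eq_iff (hex y)).2 ⟨?_, ?_⟩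
    · rw [hxy]; exact hlev x
    · intro m hm
      rw [hagree m hm.le, not_not]
      exact hlevmin x m hm
  · intro x hx
    rcases h : lev x with _ | m
    · exact Finset.mem_union_left _ (Finset.mem_image.2 ⟨_, hG 0 x hx, rfl⟩)
    · refine Finset.mem_union_right _ (Finset.mem_biUnion.2 ⟨m, ?_, ?_⟩)
      · have := hlevle x
        exact Finset.mem_range.2 (by omega)
      · refine Finset.mem_biUnion.2 ⟨idx m x, hlevmin x m (by omega), ?_⟩
        exact Finset.mem_image.2 ⟨_, hch m x, rfl⟩
  · have h1 : F.card ≤ (G 0).card + ∑ m ∈ Finset.range M, (X m).card * b := by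
      refine (Finset.card_union_le _ _).trans (add_le_add Finset.card_image_le ?_)
      refine Finset.card_biUnion_le.trans (Finset.sum_le_sum fun m _ => ?_)
      refine Finset.card_biUnion_le_card_mul _ _ _ fun i _ => ?_
      exact Finset.card_image_le.trans (hb m i)
    have h2 : ∑ m ∈ Finset.range M, ((X m).card : ℝ) ≤ S := by
      refine le_trans ?_ (hS M)
      calc ∑ m ∈ Finset.range M, ((X m).card : ℝ)
          ≤ ∑ m ∈ Finset.range M, ∑ k ∈ Finset.Ico m M, N k :=
            Finset.sum_le_sum fun m _ => hXcard m
        _ = ∑ k ∈ Finset.range M, ∑ m ∈ Finset.range (k + 1), N k := by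
            refine Finset.sum_comm' fun m k => ?_
            simp only [Finset.mem_range, Finset.mem_Ico]
            omega
        -- A cell selected at index `k` is charged once at each level `0, …, k`, whence the factor
        -- `k + 1`.
        _ = ∑ k ∈ Finset.range M, ((k : ℝ) + 1) * N k := by
            refine Finset.sum_congr rfl fun k _ => ?_
            simp
    calc (F.card : ℝ) ≤ ((G 0).card + ∑ m ∈ Finset.range M, (X m).card * b : ℕ) := by
          exact_mod_cast h1
      _ = (G 0).card + b * ∑ m ∈ Finset.range M, ((X m).card : ℝ) := by
          push_cast
          rw [Finset.mul_sum]
          congr 1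
          exact Finset.sum_congr rfl fun _ _ => mul_comm _ _
      _ ≤ _ := by gcongr
  -- The uniform `L_q` bound on `P K - t` passes to `s - t` by Fatou, along an a.e. convergent
  -- subsequence, shifted by `M` so that the telescoping applies.
  · have hmeas : TendstoInMeasure μ P atTop s := by
      refine tendstoInMeasure_of_tendsto_eLpNorm hp0.ne'
        (fun k => (hP k).aestronglyMeasurable) hs ?_
      refine hlim.congr fun k => ?_
      exact eLpNorm_sub_comm _ _ _ _
    obtain ⟨ns, hns, hae⟩ := hmeas.exists_seq_tendsto_ae
    have hge : ∀ n, M ≤ ns (n + M) := fun n =>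
      (Nat.le_add_left M n).trans (hns.id_le (n + M))
    have hae' : ∀ᵐ x ∂μ, Tendsto (fun n => (P (ns (n + M)) - t) x) atTop (𝓝 ((s - t) x)) := by
      filter_upwards [hae] with x hx
      exact ((tendsto_add_atTop_iff_nat M).2 hx).sub_const (t x)
    refine (Lp.eLpNorm_lim_le_liminf_eLpNorm (fun n => hPt _ (hge n)) _ hae').trans ?_
    refine (liminf_le_liminf (v := fun _ => ∑' k,
      ENNReal.ofReal (B k * (W k / N k) ^ (p⁻¹.toReal - q⁻¹.toReal)))
      (Eventually.of_forall fun n => hbound _ (hge n))).trans ?_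
    simp

/-! ### Dyadic intervals and rectangles through their positions. -/

/-- The position of the dyadic interval of generation `j` which contains `x ≥ 0`. -/
def dyadicIndex (j : ℕ) (x : ℝ) : ℕ := ⌈2 ^ j * x⌉₊ - 1

lemma measurable_dyadicIndex (j : ℕ) : Measurable (dyadicIndex j) :=
  (measurable_of_countable fun n : ℕ => n - 1).comp
    (Nat.measurable_ceil.comp (measurable_const.mul measurable_id))

lemma dyadicIndex_eq_succ_iff {j k : ℕ} {x : ℝ} :
    dyadicIndex j x = k + 1 ↔ ((k + 1 : ℕ) : ℝ) < 2 ^ j * x ∧ 2 ^ j * x ≤ (k + 1 : ℕ) + 1 := by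
  have h : dyadicIndex j x = k + 1 ↔ ⌈2 ^ j * x⌉₊ = k + 2 := by
    unfold dyadicIndex
    omega
  rw [h, Nat.ceil_eq_iff (by omega)]
  push_cast
  norm_num [add_assoc]

/-- Truncated subtraction merges the ceilings 0 and 1, which matches the first interval being closed
at 0. -/
lemma dyadicIndex_eq_zero_iff {j : ℕ} {x : ℝ} : dyadicIndex j x = 0 ↔ 2 ^ j * x ≤ 1 := by
  have h : dyadicIndex j x = 0 ↔ ⌈2 ^ j * x⌉₊ ≤ 1 := by
    unfold dyadicIndex
    omega
  rw [h, Nat.ceil_le, Nat.cast_one]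

lemma mem_dyadicInterval_iff {j k : ℕ} {x : ℝ} :
    x ∈ dyadicInterval j k ↔ 0 ≤ x ∧ dyadicIndex j x = k := by
  have h2 : (0 : ℝ) < 2 ^ j := by positivity
  rcases k with _ | k
  · simp only [dyadicInterval, if_true, Set.mem_Icc, dyadicIndex_eq_zero_iff, le_div_iff₀ h2,
      mul_comm x]
  · simp only [dyadicInterval, Nat.succ_ne_zero, if_false, Set.mem_Ioc, dyadicIndex_eq_succ_iff,
      div_lt_iff₀ h2, le_div_iff₀ h2, mul_comm x]
    constructor
    · rintro ⟨h, h'⟩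
      refine ⟨?_, h, h'⟩
      have : (0 : ℝ) < 2 ^ j * x := lt_of_le_of_lt (Nat.cast_nonneg _) h
      exact (pos_of_mul_pos_right this h2.le).le
    · rintro ⟨_, h⟩
      exact h

/-- Nestedness of dyadic intervals in arithmetic form: the position of the ancestor is a Euclidean
quotient. -/
lemma dyadicIndex_add_div (j e : ℕ) (x : ℝ) :
    dyadicIndex (j + e) x / 2 ^ e = dyadicIndex j x := by
  have he : (0 : ℝ) < 2 ^ e := by positivity
  have hmul : (2 : ℝ) ^ (j + e) * x = 2 ^ e * (2 ^ j * x) := by ring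
  rcases h : dyadicIndex j x with _ | k
  · rw [dyadicIndex_eq_zero_iff] at h
    refine Nat.div_eq_of_lt ?_
    have h1 : ⌈(2 : ℝ) ^ (j + e) * x⌉₊ ≤ 2 ^ e := by
      rw [Nat.ceil_le, hmul]
      push_cast
      nlinarith
    have h2 : 0 < 2 ^ e := by positivity
    unfold dyadicIndex
    omega
  · rw [dyadicIndex_eq_succ_iff] at h
    have h1 : ⌈(2 : ℝ) ^ (j + e) * x⌉₊ ≤ 2 ^ e * (k + 1 + 1) := by
      rw [Nat.ceil_le, hmul]
      push_cast
      push_cast at h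
      nlinarith
    have h2 : 2 ^ e * (k + 1) < ⌈(2 : ℝ) ^ (j + e) * x⌉₊ := by
      rw [Nat.lt_ceil, hmul]
      push_cast
      push_cast at h
      nlinarith
    refine Nat.div_eq_of_lt_le ?_ ?_
    · unfold dyadicIndex
      rw [mul_comm]
      omega
    · unfold dyadicIndex
      rw [mul_comm (_ + 1)]
      omega

lemma dyadicIndex_lt (j : ℕ) {x : ℝ} (hx : x ≤ 1) : dyadicIndex j x < 2 ^ j := by
  have h1 : ⌈(2 : ℝ) ^ j * x⌉₊ ≤ 2 ^ j := by
    rw [Nat.ceil_le]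
    push_cast
    have : (0 : ℝ) < 2 ^ j := by positivity
    nlinarith
  have h2 : 0 < 2 ^ j := by positivity
  unfold dyadicIndex
  omega

variable {d : ℕ}

/-- The dyadic rectangle of generation `j` and position `k`. -/
def cell (j k : Fin d → ℕ) : Set (Fin d → ℝ) :=
  Set.univ.pi fun l => dyadicInterval (j l) (k l)

/-- The position of the dyadic rectangle of generation `j` which contains `x ≥ 0`. -/
def cellIndex (j : Fin d → ℕ) (x : Fin d → ℝ) : Fin d → ℕ := fun l => dyadicIndex (j l) (x l)

lemma measurable_cellIndex (j : Fin d → ℕ) : Measurable (cellIndex j) :=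
  measurable_pi_lambda _ fun l => (measurable_dyadicIndex _).comp (measurable_pi_apply l)

lemma mem_cell_iff {j k : Fin d → ℕ} {x : Fin d → ℝ} :
    x ∈ cell j k ↔ 0 ≤ x ∧ cellIndex j x = k := by
  simp only [cell, Set.mem_univ_pi, mem_dyadicInterval_iff, Pi.le_def, funext_iff, cellIndex,
    Pi.zero_apply, forall_and]

lemma mem_cell_cellIndex (j : Fin d → ℕ) {x : Fin d → ℝ} (hx : 0 ≤ x) :
    x ∈ cell j (cellIndex j x) := mem_cell_iff.2 ⟨hx, rfl⟩

lemma mem_unitCube_iff {x : Fin d → ℝ} : x ∈ unitCube d ↔ 0 ≤ x ∧ ∀ l, x l ≤ 1 := by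
  simp [unitCube, Pi.le_def]

lemma cellIndex_lt {j : Fin d → ℕ} {x : Fin d → ℝ} (hx : x ∈ unitCube d) (l : Fin d) :
    cellIndex j x l < 2 ^ j l := dyadicIndex_lt _ ((mem_unitCube_iff.1 hx).2 l)

lemma cell_subset_unitCube {j k : Fin d → ℕ} (hk : ∀ l, k l < 2 ^ j l) :
    cell j k ⊆ unitCube d := by
  intro x hx
  rw [mem_cell_iff] at hx
  refine mem_unitCube_iff.2 ⟨hx.1, fun l => ?_⟩
  have h : dyadicIndex (j l) (x l) < 2 ^ j l := by
    rw [show dyadicIndex (j l) (x l) = k l from congrFun hx.2 l]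
    exact hk l
  have h1 : ⌈(2 : ℝ) ^ j l * x l⌉₊ ≤ 2 ^ j l := by
    unfold dyadicIndex at h
    omega
  rw [Nat.ceil_le] at h1
  push_cast at h1
  have h2 : (0 : ℝ) < 2 ^ j l := by positivity
  exact le_of_mul_le_mul_left (by linarith) h2

lemma cell_mem_dyadicRectangles {j k : Fin d → ℕ} (hk : ∀ l, k l < 2 ^ j l) :
    cell j k ∈ dyadicRectangles d := ⟨j, k, hk, rfl⟩

lemma cell_nonempty (j k : Fin d → ℕ) : (cell j k).Nonempty := by
  refine ⟨fun l => ((k l : ℝ) + 1) / 2 ^ j l, mem_cell_iff.2 ⟨fun l => ?_, funext fun l => ?_⟩⟩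
  · simp only [Pi.zero_apply]
    positivity
  · have h : (2 : ℝ) ^ j l * (((k l : ℝ) + 1) / 2 ^ j l) = ((k l + 1 : ℕ) : ℝ) := by
      push_cast
      field_simp
    simp only [cellIndex, dyadicIndex, h, Nat.ceil_natCast, Nat.add_sub_cancel]

/-! ### Partitions with a prescribed number of rectangles. -/

/-- A dyadic rectangle is the disjoint union of two dyadic rectangles. -/
lemma exists_split (hd : 1 ≤ d) {K : Set (Fin d → ℝ)} (hK : K ∈ dyadicRectangles d) :
    ∃ K₀ ∈ dyadicRectangles d, ∃ K₁ ∈ dyadicRectangles d,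
      K₀ ∪ K₁ = K ∧ Disjoint K₀ K₁ ∧ K₀.Nonempty ∧ K₁.Nonempty := by
  obtain ⟨j, k, hk, rfl⟩ := hK
  let o : Fin d := ⟨0, hd⟩
  -- Halve the first side; the halves have positions `2 k` and `2 k + 1` there.
  let j' := Function.update j o (j o + 1)
  have hlt : ∀ i, i < 2 → ∀ l, Function.update k o (2 * k o + i) l < 2 ^ j' l := by
    intro i hi l
    by_cases h : l = o
    · subst h
      have := hk o
      simp only [j', Function.update_self, pow_succ]
      omega
    · simpa only [j', Function.update_of_ne h] using hk l
  have hmem : ∀ i, i < 2 → ∀ x : Fin d → ℝ, x ∈ cell j' (Function.update k o (2 * k o + i)) ↔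
      0 ≤ x ∧ cellIndex j x = k ∧ dyadicIndex (j o + 1) (x o) = 2 * k o + i := by
    intro i hi x
    rw [mem_cell_iff]
    refine and_congr_right fun _ => ?_
    have hdiv := dyadicIndex_add_div (j o) 1 (x o)
    rw [pow_one] at hdiv
    constructor
    · intro h
      have ho : dyadicIndex (j o + 1) (x o) = 2 * k o + i := by
        simpa [cellIndex, j'] using congrFun h o
      refine ⟨funext fun l => ?_, ho⟩
      by_cases hl : l = o
      · subst hl
        change dyadicIndex (j o) (x o) = k o
        omega
      · simpa [cellIndex, j', hl] using congrFun h l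
    · rintro ⟨h, ho⟩
      funext l
      by_cases hl : l = o
      · subst hl
        simpa [cellIndex, j'] using ho
      · simpa [cellIndex, j', hl] using congrFun h l
  refine ⟨_, cell_mem_dyadicRectangles (hlt 0 (by norm_num)), _,
    cell_mem_dyadicRectangles (hlt 1 (by norm_num)), ?_, ?_, cell_nonempty _ _,
    cell_nonempty _ _⟩
  · ext x
    change _ ↔ x ∈ cell j k
    rw [Set.mem_union, hmem 0 (by norm_num), hmem 1 (by norm_num), mem_cell_iff]
    constructor
    · rintro (h | h) <;> exact ⟨h.1, h.2.1⟩
    · rintro ⟨h0, h⟩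
      have hdiv := dyadicIndex_add_div (j o) 1 (x o)
      rw [pow_one, show dyadicIndex (j o) (x o) = k o from congrFun h o] at hdiv
      have : dyadicIndex (j o + 1) (x o) = 2 * k o + 0 ∨
          dyadicIndex (j o + 1) (x o) = 2 * k o + 1 := by omega
      exact this.imp (fun e => ⟨h0, h, e⟩) (fun e => ⟨h0, h, e⟩)
  · rw [Set.disjoint_left]
    intro x h0 h1
    rw [hmem 0 (by norm_num)] at h0
    rw [hmem 1 (by norm_num)] at h1
    have := h0.2.2.symm.trans h1.2.2
    omega

lemma unitCube_nonempty : (unitCube d).Nonempty := ⟨0, by simp [unitCube]⟩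

/-- A partition into dyadic rectangles can be refined so as to have one more element. -/
lemma exists_refinement_succ (hd : 1 ≤ d) {c : ℕ} {m : Finset (Set (Fin d → ℝ))}
    (hm : m ∈ dyadicPartitions d c) :
    ∃ m' ∈ dyadicPartitions d (c + 1), ∀ K ∈ m', ∃ L ∈ m, K ⊆ L := by
  classical
  obtain ⟨hrect, hdisj, hcov, hcard⟩ := hm
  obtain ⟨K, hK⟩ : ∃ K, K ∈ m := by
    obtain ⟨x, hx⟩ := unitCube_nonempty (d := d)
    rw [← hcov] at hx
    obtain ⟨K, hK, -⟩ := Set.mem_iUnion₂.1 hx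
    exact ⟨K, hK⟩
  obtain ⟨K₀, hK₀, K₁, hK₁, hun, hdis, hn₀, hn₁⟩ := exists_split hd (hrect K hK)
  have hs₀ : K₀ ⊆ K := hun ▸ Set.subset_union_left
  have hs₁ : K₁ ⊆ K := hun ▸ Set.subset_union_right
  have hd' : ∀ L ∈ m.erase K, Disjoint K L := fun L hL =>
    hdisj K hK L (Finset.mem_of_mem_erase hL) (Finset.ne_of_mem_erase hL).symm
  -- Nonempty halves of `K` are new to the family, so the cardinality grows by exactly one.
  have hnot : ∀ A, A ⊆ K → A.Nonempty → A ∉ m.erase K := by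
    rintro A hA ⟨x, hx⟩ hAm
    exact Set.disjoint_left.1 (hd' A hAm) (hA hx) hx
  have hne : K₀ ≠ K₁ := by
    rintro rfl
    exact hn₀.ne_empty (disjoint_self.1 hdis)
  refine ⟨insert K₀ (insert K₁ (m.erase K)), ⟨?_, ?_, ?_, ?_⟩, ?_⟩
  · intro L hL
    rcases Finset.mem_insert.1 hL with rfl | hL
    · exact hK₀
    rcases Finset.mem_insert.1 hL with rfl | hL
    · exact hK₁
    exact hrect L (Finset.mem_of_mem_erase hL)
  · intro A hA A' hA' hAA'
    rcases Finset.mem_insert.1 hA with rfl | hA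
    · rcases Finset.mem_insert.1 hA' with rfl | hA'
      · exact absurd rfl hAA'
      rcases Finset.mem_insert.1 hA' with rfl | hA'
      · exact hdis
      · exact (hd' _ hA').mono_left hs₀
    rcases Finset.mem_insert.1 hA with rfl | hAm
    · rcases Finset.mem_insert.1 hA' with rfl | hA'
      · exact hdis.symm
      rcases Finset.mem_insert.1 hA' with rfl | hA'
      · exact absurd rfl hAA'
      · exact (hd' _ hA').mono_left hs₁
    rcases Finset.mem_insert.1 hA' with rfl | hA'
    · exact ((hd' _ hAm).mono_left hs₀).symm
    rcases Finset.mem_insert.1 hA' with rfl | hA'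
    · exact ((hd' _ hAm).mono_left hs₁).symm
    · exact hdisj _ (Finset.mem_of_mem_erase hAm) _ (Finset.mem_of_mem_erase hA') hAA'
  · rw [Finset.set_biUnion_insert, Finset.set_biUnion_insert, ← Set.union_assoc, hun, ← hcov]
    conv_rhs => rw [← Finset.insert_erase hK, Finset.set_biUnion_insert]
  · rw [Finset.card_insert_of_notMem, Finset.card_insert_of_notMem (hnot _ hs₁ hn₁),
      Finset.card_erase_add_one hK, hcard]
    rw [Finset.mem_insert, not_or]
    exact ⟨hne, hnot _ hs₀ hn₀⟩
  · intro L hL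
    rcases Finset.mem_insert.1 hL with rfl | hL
    · exact ⟨K, hK, hs₀⟩
    rcases Finset.mem_insert.1 hL with rfl | hL
    · exact ⟨K, hK, hs₁⟩
    exact ⟨L, Finset.mem_of_mem_erase hL, subset_rfl⟩

/-- The adaptive construction yields at most `D` rectangles while `dyadicPartitions` asks for
exactly `D`; refining keeps a function piecewise polynomial. -/
lemma exists_refinement (hd : 1 ≤ d) {c D : ℕ} (hcD : c ≤ D) {m : Finset (Set (Fin d → ℝ))}
    (hm : m ∈ dyadicPartitions d c) :
    ∃ m' ∈ dyadicPartitions d D, ∀ K ∈ m', ∃ L ∈ m, K ⊆ L := by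
  induction D, hcD using Nat.le_induction with
  | base => exact ⟨m, hm, fun K hK => ⟨K, hK, subset_rfl⟩⟩
  | succ n _ ih =>
    obtain ⟨m₁, hm₁, h₁⟩ := ih
    obtain ⟨m₂, hm₂, h₂⟩ := exists_refinement_succ hd hm₁
    refine ⟨m₂, hm₂, fun K hK => ?_⟩
    obtain ⟨L, hL, hKL⟩ := h₂ K hK
    obtain ⟨L', hL', hLL'⟩ := h₁ L hL
    exact ⟨L', hL', hKL.trans hLL'⟩

/-- The partition associated with a level function. -/
lemma exists_partition_of_level (hd : 1 ≤ d) (r : Fin d → ℕ) (j : ℕ → Fin d → ℕ)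
    {lev : (Fin d → ℝ) → ℕ} {F : Finset (ℕ × (Fin d → ℕ))}
    (hlev : ∀ x y, cellIndex (j (lev x)) y = cellIndex (j (lev x)) x → lev y = lev x)
    (hF : ∀ x ∈ unitCube d, (lev x, cellIndex (j (lev x)) x) ∈ F)
    {Q : ℕ → (Fin d → ℕ) → MvPolynomial (Fin d) ℝ} (hQ : ∀ k i, Q k i ∈ polys r)
    {D : ℕ} (hD : F.card ≤ D) :
    ∃ m ∈ dyadicPartitions d D,
      (fun x => MvPolynomial.eval x (Q (lev x) (cellIndex (j (lev x)) x))) ∈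
        piecewisePolys r (m : Set (Set (Fin d → ℝ))) := by
  classical
  let C : (Fin d → ℝ) → Set (Fin d → ℝ) := fun x => cell (j (lev x)) (cellIndex (j (lev x)) x)
  have hCx : ∀ x ∈ unitCube d, x ∈ C x := fun x hx =>
    mem_cell_cellIndex _ (mem_unitCube_iff.1 hx).1
  have hCeq : ∀ x y, y ∈ C x →
      lev y = lev x ∧ cellIndex (j (lev y)) y = cellIndex (j (lev x)) x := by
    intro x y hy
    have h := (mem_cell_iff.1 hy).2
    have h' := hlev x y h
    exact ⟨h', by rw [h', h]⟩
  have hCC : ∀ x y, y ∈ C x → C y = C x := by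
    intro x y hy
    obtain ⟨h1, h2⟩ := hCeq x y hy
    simp only [C]
    rw [h2, h1]
  -- The filter discards labels in `F` that are not terminal cells of points of the cube.
  let m : Finset (Set (Fin d → ℝ)) := (F.image fun a => cell (j a.1) a.2).filter
    fun K => ∃ x ∈ unitCube d, K = C x
  have hm : ∀ K, K ∈ m ↔ ∃ x ∈ unitCube d, K = C x := by
    intro K
    refine Finset.mem_filter.trans (and_iff_right_of_imp ?_)
    rintro ⟨x, hx, rfl⟩
    exact Finset.mem_image.2 ⟨_, hF x hx, rfl⟩
  have hpart : m ∈ dyadicPartitions d m.card := by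
    refine ⟨?_, ?_, ?_, rfl⟩
    · intro K hK
      obtain ⟨x, hx, rfl⟩ := (hm K).1 hK
      exact cell_mem_dyadicRectangles fun l => cellIndex_lt hx l
    · intro K hK L hL hKL
      obtain ⟨x, hx, rfl⟩ := (hm K).1 hK
      obtain ⟨y, hy, rfl⟩ := (hm L).1 hL
      rw [Set.disjoint_left]
      intro z hzx hzy
      exact hKL ((hCC x z hzx).symm.trans (hCC y z hzy))
    · ext z
      rw [Set.mem_iUnion₂]
      constructor
      · rintro ⟨K, hK, hz⟩
        obtain ⟨x, hx, rfl⟩ := (hm K).1 hK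
        exact cell_subset_unitCube (fun l => cellIndex_lt hx l) hz
      · intro hz
        exact ⟨C z, (hm _).2 ⟨z, hz, rfl⟩, hCx z hz⟩
  have hmF : m.card ≤ D :=
    (Finset.card_filter_le _ _).trans (Finset.card_image_le.trans hD)
  obtain ⟨m', hm', href⟩ := exists_refinement hd hmF hpart
  refine ⟨m', hm', fun K hK => ?_⟩
  obtain ⟨L, hL, hKL⟩ := href K hK
  obtain ⟨x, hx, rfl⟩ := (hm L).1 hL
  refine ⟨_, hQ (lev x) (cellIndex (j (lev x)) x), fun y hy => ?_⟩
  obtain ⟨h1, h2⟩ := hCeq x y (hKL hy)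
  change MvPolynomial.eval y (Q (lev y) (cellIndex (j (lev y)) y)) = _
  rw [h2, h1]

/-! ### Ancestors, descendants and cell counts. -/

/-- The index of the ancestor of generation `j` of the dyadic rectangle of generation `j'` and
position `k`. -/
def ancestor (j j' k : Fin d → ℕ) : Fin d → ℕ := fun l => k l / 2 ^ (j' l - j l)

lemma ancestor_cellIndex {j j' : Fin d → ℕ} (h : j ≤ j') (x : Fin d → ℝ) :
    ancestor j j' (cellIndex j' x) = cellIndex j x := by
  funext l
  have := dyadicIndex_add_div (j l) (j' l - j l) (x l)
  rwa [Nat.add_sub_cancel' (h l)] at this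

/-- The positions of the dyadic rectangles of generation `j'` contained in that of generation `j`
and position `k`. -/
def descendants (j j' k : Fin d → ℕ) : Finset (Fin d → ℕ) :=
  Fintype.piFinset fun l =>
    Finset.Ico (k l * 2 ^ (j' l - j l)) (k l * 2 ^ (j' l - j l) + 2 ^ (j' l - j l))

lemma cellIndex_mem_descendants {j j' : Fin d → ℕ} (h : j ≤ j') (x : Fin d → ℝ) :
    cellIndex j' x ∈ descendants j j' (cellIndex j x) := by
  refine Fintype.mem_piFinset.2 fun l => ?_
  have h1 : cellIndex j' x l / 2 ^ (j' l - j l) = cellIndex j x l :=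
    congrFun (ancestor_cellIndex h x) l
  have h2 : 0 < 2 ^ (j' l - j l) := by positivity
  rw [← h1, Finset.mem_Ico]
  exact ⟨Nat.div_mul_le_self _ _, Nat.lt_div_mul_add h2⟩

lemma card_descendants_le {j j' : Fin d → ℕ} (h : ∀ l, j' l ≤ j l + 1) (k : Fin d → ℕ) :
    (descendants j j' k).card ≤ 2 ^ d := by
  rw [descendants, Fintype.card_piFinset]
  calc _ ≤ ∏ _l : Fin d, 2 := by
        refine Finset.prod_le_prod' fun l _ => ?_
        rw [Nat.card_Ico, Nat.add_sub_cancel_left]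
        calc 2 ^ (j' l - j l) ≤ 2 ^ 1 :=
              Nat.pow_le_pow_right (by norm_num) (by have := h l; omega)
          _ = 2 := pow_one 2
    _ = _ := by simp

/-- The positions of the dyadic rectangles of generation `j`. -/
def positions (j : Fin d → ℕ) : Finset (Fin d → ℕ) :=
  Fintype.piFinset fun l => Finset.range (2 ^ j l)

lemma cellIndex_mem_positions (j : Fin d → ℕ) {x : Fin d → ℝ} (hx : x ∈ unitCube d) :
    cellIndex j x ∈ positions j :=
  Fintype.mem_piFinset.2 fun l => Finset.mem_range.2 (cellIndex_lt hx l)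

lemma card_positions (j : Fin d → ℕ) : (positions j).card = 2 ^ ∑ l, j l := by
  simp [positions, Fintype.card_piFinset, Finset.prod_pow_eq_pow_sum]

/-! ### Nikolskii's inequality, by transport to the unit cube. -/

section Nikolskii

open unitInterval

/-- A nonempty relatively open set meets the dense part `(0,1)`. This makes continuous functions
embed injectively in `L_1`. -/
instance : (volume : Measure I).IsOpenPosMeasure where
  open_pos U hU hne h := by
    obtain ⟨V, hV, rfl⟩ := isOpen_induced_iff.1 hU
    obtain ⟨x, hx⟩ := hne
    have hcl : (x : ℝ) ∈ closure (Set.Ioo (0 : ℝ) 1) := by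
      rw [closure_Ioo (by norm_num)]
      exact x.2
    obtain ⟨y, hyV, hy⟩ := mem_closure_iff.1 hcl V hV hx
    have hpos : 0 < volume (V ∩ Set.Ioo (0 : ℝ) 1) :=
      (hV.inter isOpen_Ioo).measure_pos volume ⟨y, hyV, hy⟩
    refine hpos.ne' (measure_mono_null ?_ ((unitInterval.volume_apply).symm.trans h))
    rintro z ⟨hzV, hz⟩
    exact ⟨⟨z, hz.1.le, hz.2.le⟩, hzV, rfl⟩

lemma map_volume_unitInterval (j k : ℕ) :
    Measure.map (fun u : I => ((k : ℝ) + u) / 2 ^ j) volume =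
      (2 ^ j : ℝ≥0∞) • volume.restrict (dyadicInterval j k) := by
  have h2 : (0 : ℝ) < 2 ^ j := by positivity
  let g : ℝ → ℝ := fun x => (2 ^ j : ℝ)⁻¹ * (k + x)
  have hg : Measurable g := by fun_prop
  have hgv : Measure.map g volume = (2 ^ j : ℝ≥0∞) • volume := by
    have : g = (fun x => (2 ^ j : ℝ)⁻¹ * x) ∘ (fun x => (k : ℝ) + x) := rfl
    rw [this, ← Measure.map_map (by fun_prop) (by fun_prop), map_add_left_eq_self,
      Real.map_volume_mul_left (inv_ne_zero h2.ne'), inv_inv, abs_of_pos h2,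
      ENNReal.ofReal_pow (by norm_num)]
    norm_num
  have hmeas : MeasurableSet (dyadicInterval j k) := by
    unfold dyadicInterval
    split_ifs
    exacts [measurableSet_Icc, measurableSet_Ioc]
  -- For `k > 0` the preimage misses the endpoint 0, a null set.
  have hpre : g ⁻¹' dyadicInterval j k =ᵐ[volume] I := by
    rcases k with _ | k
    · refine Filter.EventuallyEq.of_eq (Set.ext fun x => ?_)
      simp only [g, dyadicInterval, if_true, Set.mem_preimage, Set.mem_Icc, inv_mul_eq_div,
        Nat.cast_zero, zero_add, div_le_div_iff_of_pos_right h2, le_div_iff₀ h2, zero_mul]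
    · have : g ⁻¹' dyadicInterval j (k + 1) = Set.Ioc 0 1 := by
        ext x
        simp only [g, dyadicInterval, Nat.succ_ne_zero, if_false, Set.mem_preimage, Set.mem_Ioc,
          inv_mul_eq_div, div_lt_div_iff_of_pos_right h2, div_le_div_iff_of_pos_right h2,
          lt_add_iff_pos_right, add_le_add_iff_left]
      rw [this]
      exact Ioc_ae_eq_Icc
  have hcomp : (fun u : I => ((k : ℝ) + u) / 2 ^ j) = g ∘ ((↑) : I → ℝ) := by
    funext u
    simp only [g, Function.comp, inv_mul_eq_div]
  rw [hcomp, ← Measure.map_map hg measurable_subtype_coe,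
    unitInterval.measurePreserving_coe.map_eq, ← Measure.restrict_congr_set hpre,
    ← Measure.restrict_map hg hmeas, hgv, Measure.restrict_smul]

/-- The affine parametrization of a closed dyadic rectangle by the unit cube. -/
def chart (j k : Fin d → ℕ) (u : Fin d → I) : Fin d → ℝ := fun l => ((k l : ℝ) + u l) / 2 ^ j l

lemma measurable_chart (j k : Fin d → ℕ) : Measurable (chart j k) := by
  unfold chart
  fun_prop

lemma map_chart_volume (j k : Fin d → ℕ) :
    Measure.map (chart j k) volume =
      (2 ^ (∑ l, j l) : ℝ≥0∞) • volume.restrict (cell j k) := by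
  have h1 : Measure.map (chart j k) volume =
      Measure.pi fun l => Measure.map (fun u : I => ((k l : ℝ) + u) / 2 ^ j l) volume :=
    Measure.pi_map_pi (μ := fun _ => (volume : Measure I))
      (f := fun l (u : I) => ((k l : ℝ) + u) / 2 ^ j l) fun l => by fun_prop
  rw [h1]
  refine Measure.pi_eq fun s hs => ?_
  rw [Measure.smul_apply, cell, volume_pi, Measure.restrict_pi_pi, Measure.pi_pi,
    smul_eq_mul, ← Finset.prod_pow_eq_pow_sum, ← Finset.prod_mul_distrib]
  refine Finset.prod_congr rfl fun l _ => ?_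
  rw [map_volume_unitInterval, Measure.smul_apply, smul_eq_mul]

lemma exists_chart_eq {j k : Fin d → ℕ} {x : Fin d → ℝ} (hx : x ∈ cell j k) :
    ∃ u, chart j k u = x := by
  have hI : ∀ l, 2 ^ j l * x l - k l ∈ I := by
    intro l
    have h : x l ∈ dyadicInterval (j l) (k l) := hx l (Set.mem_univ l)
    have h2 : (0 : ℝ) < 2 ^ j l := by positivity
    unfold dyadicInterval at h
    split_ifs at h with hk
    · rw [Set.mem_Icc, le_div_iff₀ h2] at h
      simp only [hk, Nat.cast_zero, sub_zero]
      exact ⟨mul_nonneg h2.le h.1, by linarith [h.2]⟩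
    · rw [Set.mem_Ioc, le_div_iff₀ h2, div_lt_iff₀ h2] at h
      exact ⟨by linarith [h.1], by linarith [h.2]⟩
  refine ⟨fun l => ⟨_, hI l⟩, funext fun l => ?_⟩
  simp only [chart]
  field_simp
  ring

/-- The polynomial functions of degree `≤ r l` in each direction `l`, on the unit cube. -/
def polySpace (r : Fin d → ℕ) : Submodule ℝ C(Fin d → I, ℝ) :=
  Submodule.span ℝ (Set.range fun n : (∀ l, Fin (r l + 1)) =>
    (⟨fun u => ∏ l, (u l : ℝ) ^ (n l : ℕ), by fun_prop⟩ : C(Fin d → I, ℝ)))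

instance (r : Fin d → ℕ) : FiniteDimensional ℝ (polySpace r) :=
  FiniteDimensional.span_of_finite ℝ (Set.finite_range _)

lemma exists_coeff_add_mul_pow (a b : ℝ) {m r : ℕ} (hm : m ≤ r) :
    ∃ c : Fin (r + 1) → ℝ, ∀ u : ℝ, (a + b * u) ^ m = ∑ i, c i * u ^ (i : ℕ) := by
  -- For `i > m` the truncated exponent is harmless, as `m.choose i` vanishes.
  refine ⟨fun i => b ^ (i : ℕ) * a ^ (m - i) * (m.choose i), fun u => ?_⟩
  rw [Fin.sum_univ_eq_sum_range (fun i => b ^ i * a ^ (m - i) * (m.choose i) * u ^ i) (r + 1),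
    add_comm a, add_pow, eq_comm]
  rw [← Finset.sum_subset (Finset.range_mono (Nat.succ_le_succ hm))]
  · refine Finset.sum_congr rfl fun i _ => ?_
    rw [mul_pow]
    ring
  · intro i _ hi
    rw [Nat.choose_eq_zero_of_lt (by simpa using hi)]
    simp

/-- Affine changes of each variable preserve the degree bounds, so one finite-dimensional space
serves all rectangles and the constants do not depend on the rectangle. -/
lemma exists_mem_polySpace {r : Fin d → ℕ} (j k : Fin d → ℕ) {P : MvPolynomial (Fin d) ℝ}
    (hP : P ∈ polys r) :
    ∃ f ∈ polySpace r, ∀ u, f u = MvPolynomial.eval (chart j k u) P := by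
  have hmon : ∀ m ∈ P.support, ∃ f ∈ polySpace r, ∀ u, f u = ∏ l, (chart j k u l) ^ m l := by
    intro m hm
    have hml : ∀ l, m l ≤ r l := fun l => (MvPolynomial.degreeOf_le_iff.1 (hP l)) m hm
    choose c hc using fun l =>
      exists_coeff_add_mul_pow ((k l : ℝ) / 2 ^ j l) ((2 ^ j l : ℝ)⁻¹) (hml l)
    refine ⟨∑ n : (∀ l, Fin (r l + 1)), (∏ l, c l (n l)) •
      (⟨fun u => ∏ l, (u l : ℝ) ^ (n l : ℕ), by fun_prop⟩ : C(Fin d → I, ℝ)),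
      Submodule.sum_mem _ fun n _ => Submodule.smul_mem _ _ (Submodule.subset_span ⟨n, rfl⟩), ?_⟩
    intro u
    have h1 : ∀ l, chart j k u l ^ m l = ∑ i, c l i * (u l : ℝ) ^ (i : ℕ) := by
      intro l
      rw [← hc l]
      simp only [chart]
      congr 1
      ring
    simp only [h1]
    rw [Finset.prod_univ_sum, Fintype.piFinset_univ, ContinuousMap.sum_apply]
    refine Finset.sum_congr rfl fun n _ => ?_
    simp [Finset.prod_mul_distrib]
  choose! f hf hfu using hmon
  refine ⟨∑ m ∈ P.support, P.coeff m • f m,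
    Submodule.sum_mem _ fun m hm => Submodule.smul_mem _ _ (hf m hm), fun u => ?_⟩
  rw [MvPolynomial.eval_eq', ContinuousMap.sum_apply]
  refine Finset.sum_congr rfl fun m hm => ?_
  rw [ContinuousMap.smul_apply, hfu m hm, smul_eq_mul]

/-- An injective linear map on a finite-dimensional space is bounded below; here it is the embedding
into `L_1`. -/
lemma exists_enorm_le_lintegral (r : Fin d → ℕ) :
    ∃ K : ℝ, 0 < K ∧ ∀ f ∈ polySpace r, ‖f‖ₑ ≤ ENNReal.ofReal K * ∫⁻ u, ‖f u‖ₑ := by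
  let T : polySpace r →L[ℝ] Lp ℝ 1 (volume : Measure (Fin d → I)) :=
    (ContinuousMap.toLp (E := ℝ) 1 volume ℝ).comp (polySpace r).subtypeL
  have hT : T.toLinearMap.ker = ⊥ := by
    rw [LinearMap.ker_eq_bot]
    have h : (volume : Measure (Fin d → I)).IsOpenPosMeasure := by
      rw [volume_pi]
      infer_instance
    exact (ContinuousMap.toLp_injective (p := 1) (𝕜 := ℝ) (volume : Measure (Fin d → I))).comp
      Subtype.val_injective
  obtain ⟨K, hK0, hK⟩ := @LinearMap.exists_antilipschitzWith ℝ _ (polySpace r) _ _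
    (Lp ℝ 1 (volume : Measure (Fin d → I))) _ _ _ _ T.toLinearMap hT
  refine ⟨K, by exact_mod_cast hK0, fun f hf => ?_⟩
  have h := hK ⟨f, hf⟩ 0
  rw [ContinuousLinearMap.coe_coe, map_zero, edist_zero_right, edist_zero_right, ENNReal.ofReal_coe_nnreal.symm] at h
  refine h.trans_eq ?_
  congr 1
  have h1 : (T ⟨f, hf⟩ : (Fin d → I) → ℝ) =ᵐ[volume] f := ContinuousMap.coeFn_toLp _ f
  rw [Lp.enorm_def, eLpNorm_congr_ae h1, eLpNorm_one_eq_lintegral_enorm]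

/-- For `p ≥ 1`, `L_1` is dominated by `L_p` on a probability space. For `p ≤ 1`, `|f| ≤ ‖f‖^(1-p)
|f|^p`, and the power of the sup norm cancels. -/
lemma exists_enorm_rpow_le_lintegral (r : Fin d → ℕ) {p : ℝ} (hp : 0 < p) :
    ∃ A : ℝ, 0 < A ∧ ∀ f ∈ polySpace r, ∀ u, ‖f u‖ₑ ^ p ≤
      ENNReal.ofReal A * ∫⁻ v, ‖f v‖ₑ ^ p := by
  obtain ⟨K, hK0, hK⟩ := exists_enorm_le_lintegral r
  have hle : ∀ (f : C(Fin d → I, ℝ)) u, ‖f u‖ₑ ≤ ‖f‖ₑ := fun f u =>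
    enorm_le_iff_norm_le.2 (f.norm_coe_le_norm u)
  rcases le_total 1 p with h1 | h1
  · refine ⟨K ^ p, by positivity, fun f hf u => ?_⟩
    have hmono : ∫⁻ v, ‖f v‖ₑ ≤ (∫⁻ v, ‖f v‖ₑ ^ p) ^ (1 / p) := by
      have h := eLpNorm_le_eLpNorm_of_exponent_le (μ := (volume : Measure (Fin d → I)))
        (p := 1) (q := ENNReal.ofReal p) (f := f)
        (by simpa using ENNReal.ofReal_le_ofReal h1)
        f.continuous.aestronglyMeasurable
      rwa [eLpNorm_one_eq_lintegral_enorm, eLpNorm_eq_lintegral_rpow_enorm_toReal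
        (by simpa using hp) ENNReal.ofReal_ne_top, ENNReal.toReal_ofReal hp.le] at h
    calc ‖f u‖ₑ ^ p ≤ (ENNReal.ofReal K * (∫⁻ v, ‖f v‖ₑ ^ p) ^ (1 / p)) ^ p :=
          ENNReal.rpow_le_rpow ((hle f u).trans ((hK f hf).trans (by gcongr))) hp.le
      _ = _ := by
        rw [ENNReal.mul_rpow_of_nonneg _ _ hp.le, one_div, ENNReal.rpow_inv_rpow hp.ne',
          ENNReal.ofReal_rpow_of_pos hK0]
  · refine ⟨K, hK0, fun f hf u => ?_⟩
    refine (ENNReal.rpow_le_rpow (hle f u) hp.le).trans ?_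
    rcases eq_or_ne ‖f‖ₑ 0 with h0 | h0
    · rw [h0, ENNReal.zero_rpow_of_pos hp]
      exact zero_le
    have ht : ‖f‖ₑ ≠ ∞ := enorm_ne_top
    have hint : ∫⁻ v, ‖f v‖ₑ ≤ ‖f‖ₑ ^ (1 - p) * ∫⁻ v, ‖f v‖ₑ ^ p := by
      rw [← lintegral_const_mul' _ _ (ENNReal.rpow_ne_top_of_nonneg (by linarith) ht)]
      refine lintegral_mono fun v => ?_
      calc ‖f v‖ₑ = ‖f v‖ₑ ^ (1 - p) * ‖f v‖ₑ ^ p := by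
            rw [← ENNReal.rpow_add_of_nonneg _ _ (by linarith) hp.le, sub_add_cancel,
              ENNReal.rpow_one]
        _ ≤ _ := by
            gcongr
            exact hle f v
    calc ‖f‖ₑ ^ p = ‖f‖ₑ ^ (p - 1) * ‖f‖ₑ := by
          conv_rhs => rw [← ENNReal.rpow_one ‖f‖ₑ, ← ENNReal.rpow_mul, one_mul]
          rw [← ENNReal.rpow_add _ _ h0 ht, sub_add_cancel]
      _ ≤ ‖f‖ₑ ^ (p - 1) * (ENNReal.ofReal K * (‖f‖ₑ ^ (1 - p) * ∫⁻ v, ‖f v‖ₑ ^ p)) := by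
          gcongr
          exact (hK f hf).trans (by gcongr)
      _ = (‖f‖ₑ ^ (p - 1) * ‖f‖ₑ ^ (1 - p)) * (ENNReal.ofReal K * ∫⁻ v, ‖f v‖ₑ ^ p) := by
          ring
      _ = _ := by
          rw [← ENNReal.rpow_add _ _ h0 ht, show p - 1 + (1 - p) = 0 by ring,
            ENNReal.rpow_zero, one_mul]

/-- Nikolskii's inequality on dyadic rectangles. -/
lemma exists_nikolskii (r : Fin d → ℕ) {p : ℝ} (hp : 0 < p) :
    ∃ A : ℝ, 0 < A ∧ ∀ P ∈ polys r, ∀ (j k : Fin d → ℕ), ∀ x ∈ cell j k,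
      ‖MvPolynomial.eval x P‖ₑ ^ p ≤ ENNReal.ofReal (A * 2 ^ ∑ l, j l) *
        ∫⁻ y in cell j k, ‖MvPolynomial.eval y P‖ₑ ^ p := by
  obtain ⟨A, hA, h⟩ := exists_enorm_rpow_le_lintegral r hp
  refine ⟨A, hA, fun P hP j k x hx => ?_⟩
  obtain ⟨u, rfl⟩ := exists_chart_eq hx
  obtain ⟨f, hf, hfu⟩ := exists_mem_polySpace j k hP
  have h1 := h f hf u
  simp only [hfu] at h1
  refine h1.trans_eq ?_
  have hmeas : Measurable fun y : Fin d → ℝ => ‖MvPolynomial.eval y P‖ₑ ^ p :=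
    ((MvPolynomial.continuous_eval P).measurable.enorm).pow_const p
  -- The Jacobian of the chart supplies the factor `2 ^ ∑ l, j l`.
  rw [← lintegral_map hmeas (measurable_chart j k), map_chart_volume, lintegral_smul_measure,
    smul_eq_mul, ← mul_assoc, ENNReal.ofReal_mul hA.le, ENNReal.ofReal_pow (by norm_num)]
  norm_num

end Nikolskii

/-! ### Growth of the anisotropic generations. -/

/-- The generation of the rectangles of `𝓓_k^σ`. -/
def generation (σ : Fin d → ℝ) (k : ℕ) (l : Fin d) : ℕ := ⌊(k : ℝ) * sigmaMin σ / σ l⌋₊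

section Generation

variable {σ : Fin d → ℝ}

lemma sigmaMin_le (l : Fin d) : sigmaMin σ ≤ σ l :=
  ciInf_le (Set.finite_range σ).bddBelow l

lemma sigmaMin_pos (hd : 1 ≤ d) (hσ : ∀ l, 0 < σ l) : 0 < sigmaMin σ := by
  have : Nonempty (Fin d) := ⟨⟨0, hd⟩⟩
  obtain ⟨l, hl⟩ := exists_eq_ciInf_of_finite (f := σ)
  exact (hσ l).trans_eq hl

lemma monotone_generation (hd : 1 ≤ d) (hσ : ∀ l, 0 < σ l) : Monotone (generation σ) := by
  intro k k' hk l
  have h1 := sigmaMin_pos hd hσ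
  have h2 : (k : ℝ) ≤ k' := by exact_mod_cast hk
  have h3 := hσ l
  exact Nat.floor_mono (by gcongr)

/-- As `σ_min / σ_l ≤ 1`, each side is halved at most once per level, so a cell has at most `2 ^ d`
children. -/
lemma generation_succ_le (hσ : ∀ l, 0 < σ l) (k : ℕ) (l : Fin d) :
    generation σ (k + 1) l ≤ generation σ k l + 1 := by
  unfold generation
  have h1 : sigmaMin σ / σ l ≤ 1 := (div_le_one (hσ l)).2 (sigmaMin_le l)
  have h2 : ((k + 1 : ℕ) : ℝ) * sigmaMin σ / σ l ≤ (k : ℝ) * sigmaMin σ / σ l + (1 : ℕ) := by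
    push_cast
    have : ((k : ℝ) + 1) * sigmaMin σ / σ l = k * sigmaMin σ / σ l + sigmaMin σ / σ l := by ring
    linarith
  rcases le_or_gt 0 ((k : ℝ) * sigmaMin σ / σ l) with h0 | h0
  · rw [← Nat.floor_add_natCast h0]
    exact Nat.floor_mono h2
  · calc _ ≤ ⌊((1 : ℕ) : ℝ)⌋₊ := Nat.floor_mono (h2.trans (by linarith))
      _ ≤ _ := by rw [Nat.floor_natCast]; omega

lemma two_pow_sum_generation_le (hd : 1 ≤ d) (hσ : ∀ l, 0 < σ l) (k : ℕ) :
    (2 : ℝ) ^ (∑ l, generation σ k l) ≤ ((2 : ℝ) ^ (sigmaMin σ * ∑ l, 1 / σ l)) ^ k := by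
  rw [← Real.rpow_natCast, ← Real.rpow_mul_natCast (by norm_num)]
  refine Real.rpow_le_rpow_of_exponent_le (by norm_num) ?_
  push_cast
  rw [Finset.mul_sum, Finset.sum_mul]
  refine Finset.sum_le_sum fun l _ => ?_
  have h1 := sigmaMin_pos hd hσ
  have h2 := hσ l
  refine (Nat.floor_le (by positivity)).trans_eq ?_
  ring

end Generation

/-! ### Measurability and near-best approximations. -/

lemma measurableSet_of_mem_dyadicRectangles {K : Set (Fin d → ℝ)} (hK : K ∈ dyadicRectangles d) :
    MeasurableSet K := by
  obtain ⟨j, k, -, rfl⟩ := hK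
  refine MeasurableSet.univ_pi fun l => ?_
  unfold dyadicInterval
  split_ifs
  exacts [measurableSet_Icc, measurableSet_Ioc]

lemma aemeasurable_of_mem_piecewisePolys {r : Fin d → ℕ} {D : ℕ}
    {m : Finset (Set (Fin d → ℝ))} (hm : m ∈ dyadicPartitions d D) {t : (Fin d → ℝ) → ℝ}
    (ht : t ∈ piecewisePolys r (m : Set (Set (Fin d → ℝ)))) : AEMeasurable t (cubeMeasure d) := by
  obtain ⟨hrect, -, hcov, -⟩ := hm
  have h : (⋃ K : m, (K : Set (Fin d → ℝ))) = unitCube d := by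
    rw [← hcov, Set.iUnion_subtype]
  rw [cubeMeasure, ← h, aemeasurable_iUnion_iff]
  rintro ⟨K, hK⟩
  obtain ⟨P, -, hP⟩ := ht K hK
  refine ((MvPolynomial.continuous_eval P).measurable.aemeasurable).congr ?_
  filter_upwards [ae_restrict_mem (measurableSet_of_mem_dyadicRectangles (hrect K hK))] with x hx
  exact (hP x hx).symm

instance : IsProbabilityMeasure (cubeMeasure d) := ⟨by
  simp [cubeMeasure, unitCube, Real.volume_Icc_pi]⟩

lemma ae_mem_unitCube : ∀ᵐ x ∂cubeMeasure d, x ∈ unitCube d :=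
  ae_restrict_mem measurableSet_Icc

/-- `N_∞ ≤ N_{p'}`: this is why the final constant does not depend on `p'`. -/
lemma mul_approxError_le_of_smoothness_le {r : Fin d → ℕ} {σ : Fin d → ℝ} {p p' : ℝ≥0∞}
    (hp' : 0 < p') {s : (Fin d → ℝ) → ℝ} {b : ℝ≥0∞} (h : smoothness r σ p p' s ≤ b) (k : ℕ) :
    2 ^ ((k : ℝ) * sigmaMin σ) * approxError r σ p k s ≤ b := by
  unfold smoothness at h
  split_ifs at h with ht
  · exact (le_iSup (fun k : ℕ => 2 ^ ((k : ℝ) * sigmaMin σ) * approxError r σ p k s) k).trans h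
  · have hpr : 0 < p'.toReal := ENNReal.toReal_pos hp'.ne' ht
    refine le_trans ?_ h
    rw [one_div, ENNReal.le_rpow_inv_iff hpr]
    exact ENNReal.le_tsum (f := fun k : ℕ =>
      (2 ^ ((k : ℝ) * sigmaMin σ) * approxError r σ p k s) ^ p'.toReal) k

/-- Near best approximations, in a form which is measurable on the whole space. -/
lemma exists_near_best {r : Fin d → ℕ} {σ : Fin d → ℝ} {p : ℝ≥0∞} {s : (Fin d → ℝ) → ℝ}
    {k : ℕ} {b : ℝ} (hb : approxError r σ p k s < ENNReal.ofReal b) :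
    ∃ Q : (Fin d → ℕ) → MvPolynomial (Fin d) ℝ, (∀ i, Q i ∈ polys r) ∧
      eLpNorm (s - fun x => MvPolynomial.eval x (Q (cellIndex (generation σ k) x))) p
        (cubeMeasure d) ≤ ENNReal.ofReal b := by
  classical
  unfold approxError at hb
  obtain ⟨T, hT⟩ := iInf_lt_iff.1 hb
  obtain ⟨hTp, hT⟩ := iInf_lt_iff.1 hT
  have hex : ∀ i : Fin d → ℕ, ∃ P ∈ polys r, i ∈ positions (generation σ k) →
      ∀ x ∈ cell (generation σ k) i, T x = MvPolynomial.eval x P := by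
    intro i
    by_cases hi : i ∈ positions (generation σ k)
    · obtain ⟨P, hP, h⟩ := hTp (cell (generation σ k) i)
        ⟨i, fun l => Finset.mem_range.1 (Fintype.mem_piFinset.1 hi l), rfl⟩
      exact ⟨P, hP, fun _ => h⟩
    · exact ⟨0, fun l => by simp, fun h => absurd h hi⟩
  choose Q hQ hQT using hex
  refine ⟨Q, hQ, le_trans (le_of_eq (eLpNorm_congr_ae ?_)) hT.le⟩
  filter_upwards [ae_mem_unitCube] with x hx
  simp only [Pi.sub_apply]
  rw [hQT _ (cellIndex_mem_positions _ hx) x (mem_cell_cellIndex _ (mem_unitCube_iff.1 hx).1)]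

lemma measurable_apply_countable {Ω ι : Type*} [MeasurableSpace Ω] [MeasurableSpace ι]
    [Countable ι] [MeasurableSingletonClass ι] {f : ι → Ω → ℝ} (hf : ∀ i, Measurable (f i))
    {g : Ω → ι} (hg : Measurable g) : Measurable fun x => f (g x) x := by
  have h : Measurable fun a : ι × Ω => f a.1 a.2 := measurable_from_prod_countable_right hf
  exact h.comp (hg.prodMk measurable_id)

lemma measurable_eval_cellIndex (j : Fin d → ℕ) (Q : (Fin d → ℕ) → MvPolynomial (Fin d) ℝ) :
    Measurable fun x => MvPolynomial.eval x (Q (cellIndex j x)) :=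
  measurable_apply_countable (f := fun i x => MvPolynomial.eval x (Q i))
    (fun i => (MvPolynomial.continuous_eval (Q i)).measurable) (measurable_cellIndex j)

lemma sub_mem_polys {r : Fin d → ℕ} {P Q : MvPolynomial (Fin d) ℝ} (hP : P ∈ polys r)
    (hQ : Q ∈ polys r) : P - Q ∈ polys r := fun l =>
  (MvPolynomial.degreeOf_sub_le l P Q).trans (max_le (hP l) (hQ l))

lemma setLIntegral_cellIndex_fiber {j : Fin d → ℕ} {x : Fin d → ℝ} (hx : x ∈ unitCube d)
    (f : (Fin d → ℝ) → ℝ≥0∞) :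
    ∫⁻ y in cellIndex j ⁻¹' {cellIndex j x}, f y ∂cubeMeasure d =
      ∫⁻ y in cell j (cellIndex j x), f y := by
  rw [cubeMeasure, Measure.restrict_restrict
    (measurable_cellIndex j (measurableSet_singleton _))]
  congr 2
  ext y
  rw [Set.mem_inter_iff, Set.mem_preimage, Set.mem_singleton_iff]
  constructor
  · rintro ⟨h1, h2⟩
    exact mem_cell_iff.2 ⟨(mem_unitCube_iff.1 h2).1, h1⟩
  · intro h
    exact ⟨(mem_cell_iff.1 h).2, cell_subset_unitCube (fun l => cellIndex_lt hx l) h⟩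

lemma sum_add_one_mul_geometric_le {ρ n : ℝ} (hρ0 : 0 < ρ) (hρ1 : ρ < 1) (hn : 0 ≤ n) (M : ℕ) :
    ∑ k ∈ Finset.range M, ((k : ℝ) + 1) * (n * ρ ^ k) ≤ n / (1 - ρ) ^ 2 := by
  have hρ : ‖ρ‖ < 1 := by rwa [Real.norm_of_nonneg hρ0.le]
  have h := ((hasSum_coe_mul_geometric_of_norm_lt_one hρ).add
    (hasSum_geometric_of_norm_lt_one hρ)).mul_left n
  have h1 := sum_le_hasSum (Finset.range M) (fun k _ => by positivity) h
  have h2 : n * (ρ / (1 - ρ) ^ 2 + (1 - ρ)⁻¹) = n / (1 - ρ) ^ 2 := by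
    have : 1 - ρ ≠ 0 := by linarith
    field_simp
    ring
  rw [h2] at h1
  refine le_trans (le_of_eq (Finset.sum_congr rfl fun k _ => ?_)) h1
  ring

/-! ### Choice of parameters and the approximation rate. -/

set_option maxHeartbeats 1000000 in
/-- Adaptive approximation in `L_q`, `p ≤ q`, from the decay of the approximation errors in
`L_p`. -/
theorem exists_adaptive_approx (hd : 1 ≤ d) (r : Fin d → ℕ) {σ : Fin d → ℝ} (hσ : ∀ l, 0 < σ l)
    {p q : ℝ≥0∞} (hp0 : 0 < p) (hp : p < ∞) (hpq : p ≤ q) (hq : 1 ≤ q)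
    (hH : p⁻¹.toReal - q⁻¹.toReal < harmonicMean σ / d) :
    ∃ C : ℝ, 0 < C ∧ ∀ s : (Fin d → ℝ) → ℝ, AEStronglyMeasurable s (cubeMeasure d) →
      ∀ R : ℝ, 0 < R →
      (∀ k : ℕ, 2 ^ ((k : ℝ) * sigmaMin σ) * approxError r σ p k s ≤ ENNReal.ofReal R) →
      ∀ D : ℕ, 1 ≤ D → ∃ m ∈ dyadicPartitions d D,
        ∃ t ∈ piecewisePolys r (m : Set (Set (Fin d → ℝ))),
          cubeNorm q (s - t) ≤ ENNReal.ofReal (C * R * (D : ℝ) ^ (-(harmonicMean σ / d))) := by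
  have hpr : 0 < p.toReal := ENNReal.toReal_pos hp0.ne' hp.ne
  have hσm := sigmaMin_pos hd hσ
  have hsum : 0 < ∑ l, 1 / σ l := by
    have : Nonempty (Fin d) := ⟨⟨0, hd⟩⟩
    exact Finset.sum_pos (fun l _ => one_div_pos.2 (hσ l)) Finset.univ_nonempty
  have hα : harmonicMean σ / d = (∑ l, 1 / σ l)⁻¹ := by
    have : (d : ℝ) ≠ 0 := by
      have : 0 < d := hd
      positivity
    unfold harmonicMean
    field_simp
  rw [hα] at hH ⊢
  have hδ0 : 0 ≤ p⁻¹.toReal - q⁻¹.toReal :=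
    sub_nonneg.2 (ENNReal.toReal_mono (ENNReal.inv_ne_top.2 hp0.ne') (ENNReal.inv_le_inv.2 hpq))
  generalize hαdef : (∑ l, 1 / σ l)⁻¹ = α at hH ⊢
  generalize hδ : p⁻¹.toReal - q⁻¹.toReal = δ at hH hδ0
  generalize hy : (2 : ℝ) ^ (sigmaMin σ * ∑ l, 1 / σ l) = y
  have hgen : ∀ k, (2 : ℝ) ^ (∑ l, generation σ k l) ≤ y ^ k := by
    rw [← hy]
    exact two_pow_sum_generation_le hd hσ
  have hy1 : 1 < y := by
    rw [← hy]
    exact Real.one_lt_rpow (by norm_num) (by positivity)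
  have hy0 : 0 < y := by linarith
  have hyα : y ^ α = 2 ^ sigmaMin σ := by
    rw [← hy, ← Real.rpow_mul (by norm_num), ← hαdef, mul_assoc, mul_inv_cancel₀ hsum.ne', mul_one]
  obtain ⟨A, hA, hNik⟩ := exists_nikolskii r hpr
  -- the rates
  obtain ⟨ε, hε, hεδ⟩ : ∃ ε : ℝ, 0 < ε ∧ ε * δ < α - δ := by
    refine ⟨(α - δ) / (δ + 1), div_pos (by linarith) (by linarith), ?_⟩
    rw [div_mul_eq_mul_div, div_lt_iff₀ (by linarith)]
    nlinarith
  let β : ℝ := y ^ (-α)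
  let ρ : ℝ := y ^ (-ε)
  let θ : ℝ := y ^ (-α + δ + ε * δ)
  have hβ0 : 0 < β := Real.rpow_pos_of_pos hy0 _
  have hρ0 : 0 < ρ := Real.rpow_pos_of_pos hy0 _
  have hθ0 : 0 < θ := Real.rpow_pos_of_pos hy0 _
  have hβ1 : β < 1 := Real.rpow_lt_one_of_one_lt_of_neg hy1 (by linarith)
  have hρ1 : ρ < 1 := Real.rpow_lt_one_of_one_lt_of_neg hy1 (by linarith)
  have hθ1 : θ < 1 := Real.rpow_lt_one_of_one_lt_of_neg hy1 (by linarith)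
  -- the constants
  let c₀ : ℝ := p.LpAddConst.toReal
  have hc₀0 : 0 ≤ c₀ := ENNReal.toReal_nonneg
  have hc₀ : p.LpAddConst = ENNReal.ofReal c₀ := (ENNReal.ofReal_toReal (ENNReal.LpAddConst_lt_top p).ne).symm
  let c : ℝ := 4 * (c₀ + 1)
  have hc : 0 < c := by positivity
  -- The two bounds keep `n` and the count of refined cells `2 ^ d n / (1 - ρ) ^ 2` each at most `D
  -- / 2`.
  let c₁ : ℝ := min (1 / 2) ((1 - ρ) ^ 2 / (2 * 2 ^ d))
  have hρ1' : 0 < 1 - ρ := by linarith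
  have hc₁ : 0 < c₁ := lt_min (by norm_num) (by positivity)
  have hc₁1 : c₁ ≤ 1 / 2 := min_le_left _ _
  have hc₁2 : c₁ ≤ (1 - ρ) ^ 2 / (2 * 2 ^ d) := min_le_right _ _
  have hθ1' : 0 < 1 - θ := by linarith
  refine ⟨c * (c₁ / y) ^ (-α) * (A * y / c₁) ^ δ / (1 - θ), by positivity, ?_⟩
  intro s hs R hR happ D hD
  have hD1 : (1 : ℝ) ≤ D := by exact_mod_cast hD
  have hD0 : (0 : ℝ) < D := by linarith
  -- the approximations at each level
  have hQex : ∀ k, ∃ Q : (Fin d → ℕ) → MvPolynomial (Fin d) ℝ, (∀ i, Q i ∈ polys r) ∧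
      eLpNorm (s - fun x => MvPolynomial.eval x (Q (cellIndex (generation σ k) x))) p
        (cubeMeasure d) ≤ ENNReal.ofReal (2 * R * β ^ k) := by
    intro k
    -- The factor 2 leaves room for a strict inequality, as the infimum need not be known to be
    -- attained.
    refine exists_near_best (lt_of_le_of_lt ?_
      ((ENNReal.ofReal_lt_ofReal_iff (by positivity)).2
        (show R * β ^ k < 2 * R * β ^ k by
          have : 0 < R * β ^ k := by positivity
          linarith)))
    have h2 : (2 : ℝ≥0∞) ^ ((k : ℝ) * sigmaMin σ) = ENNReal.ofReal ((β ^ k)⁻¹) := by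
      have : (β ^ k)⁻¹ = 2 ^ ((k : ℝ) * sigmaMin σ) := by
        rw [← inv_pow, ← Real.rpow_neg hy0.le, neg_neg, hyα, mul_comm,
          Real.rpow_mul_natCast (by norm_num)]
      rw [this, ← ENNReal.ofReal_rpow_of_pos (by norm_num), ENNReal.ofReal_ofNat]
    have h3 := happ k
    rw [h2] at h3
    calc approxError r σ p k s
        = ENNReal.ofReal (β ^ k) * (ENNReal.ofReal ((β ^ k)⁻¹) * approxError r σ p k s) := by
          rw [← mul_assoc, ← ENNReal.ofReal_mul (by positivity),
            mul_inv_cancel₀ (pow_pos hβ0 k).ne', ENNReal.ofReal_one, one_mul]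
      _ ≤ ENNReal.ofReal (β ^ k) * ENNReal.ofReal R := by gcongr
      _ = ENNReal.ofReal (R * β ^ k) := by
          rw [← ENNReal.ofReal_mul (by positivity), mul_comm]
  choose Q hQ hQs using hQex
  let P : ℕ → (Fin d → ℝ) → ℝ := fun k x =>
    MvPolynomial.eval x (Q k (cellIndex (generation σ k) x))
  have hPmeas : ∀ k, Measurable (P k) := fun k => measurable_eval_cellIndex _ _
  -- the number of cells
  let n : ℝ := c₁ * D
  have hn : 0 < n := by positivity
  -- The maximum with 1 covers small `D`, where `n < 1` and `k₀ = 0`.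
  obtain ⟨k₀, hk₀, hk₀'⟩ := exists_nat_pow_near (le_max_right n 1) hy1
  have hyk : y ^ k₀ ≤ D := hk₀.trans (max_le (by simp only [n]; nlinarith) hD1)
  have hyk' : c₁ / y * D ≤ y ^ k₀ := by
    rw [div_mul_eq_mul_div, div_le_iff₀ hy0, ← pow_succ]
    exact (le_max_left n 1).trans hk₀'.le
  have hanc : ∀ k k', k ≤ k' → generation σ (k₀ + k) ≤ generation σ (k₀ + k') := fun k k' h =>
    monotone_generation hd hσ (by omega)
  obtain ⟨lev, F, hlev, hF, hFcard, herr⟩ := exists_adaptive_level (μ := cubeMeasure d) (s := s)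
    hp0 hp hpq hq
    (idx := fun k => cellIndex (generation σ (k₀ + k))) (fun k => measurable_cellIndex _)
    (proj := fun k k' => ancestor (generation σ (k₀ + k)) (generation σ (k₀ + k')))
    (fun k k' h x => ancestor_cellIndex (hanc k k' h) x)
    (Q := unitCube d) ae_mem_unitCube
    (G := fun k => positions (generation σ (k₀ + k)))
    (fun k x hx => cellIndex_mem_positions _ hx)
    (ch := fun k => descendants (generation σ (k₀ + k)) (generation σ (k₀ + (k + 1))))
    (fun k x => cellIndex_mem_descendants (hanc k (k + 1) (by omega)) x)
    (b := 2 ^ d) (fun k i => card_descendants_le (fun l => generation_succ_le hσ (k₀ + k) l) i)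
    (P := fun k => P (k₀ + k)) (fun k => hPmeas _) hs
    (by
      have h0 : Tendsto (fun k => ENNReal.ofReal (2 * R * β ^ (k₀ + k))) atTop (𝓝 0) := by
        rw [← ENNReal.ofReal_zero, ← mul_zero (2 * R)]
        refine ENNReal.tendsto_ofReal (Tendsto.const_mul _ ?_)
        simp_rw [pow_add]
        rw [← mul_zero (β ^ k₀)]
        exact (tendsto_pow_atTop_nhds_zero_of_lt_one hβ0.le hβ1).const_mul _
      exact tendsto_of_tendsto_of_tendsto_of_le_of_le tendsto_const_nhds h0
        (fun _ => zero_le) (fun k => hQs (k₀ + k)))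
    (B := fun k => c * R * β ^ (k₀ + k)) (W := fun k => A * y ^ (k₀ + k + 1))
    (N := fun k => n * ρ ^ k) (fun k => by positivity) (fun k => by positivity)
    (fun k => by positivity)
    (by
      intro k
      have h1 : P (k₀ + (k + 1)) - P (k₀ + k) = (s - P (k₀ + k)) - (s - P (k₀ + (k + 1))) := by
        abel
      have h2 := eLpNorm_sub_le' (hs.sub (hPmeas (k₀ + k)).aestronglyMeasurable)
        (hs.sub (hPmeas (k₀ + (k + 1))).aestronglyMeasurable) p
      rw [← h1, hc₀] at h2
      refine h2.trans ?_
      calc _ ≤ ENNReal.ofReal c₀ * (ENNReal.ofReal (2 * R * β ^ (k₀ + k)) +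
            ENNReal.ofReal (2 * R * β ^ (k₀ + (k + 1)))) := by
            gcongr
            · exact hQs _
            · exact hQs _
        _ = ENNReal.ofReal (c₀ * (2 * R * β ^ (k₀ + k) + 2 * R * β ^ (k₀ + (k + 1)))) := by
            rw [← ENNReal.ofReal_add (by positivity) (by positivity),
              ← ENNReal.ofReal_mul hc₀0]
        _ ≤ _ := by
            refine ENNReal.ofReal_le_ofReal ?_
            have h3 : β ^ (k₀ + (k + 1)) ≤ β ^ (k₀ + k) :=
              pow_le_pow_of_le_one hβ0.le hβ1.le (by omega)
            have h4 : 0 < R * β ^ (k₀ + k) := by positivity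
            have h5 : R * β ^ (k₀ + (k + 1)) ≤ R * β ^ (k₀ + k) := by gcongr
            have h6 : c₀ * (R * β ^ (k₀ + (k + 1))) ≤ c₀ * (R * β ^ (k₀ + k)) := by gcongr
            simp only [c]
            nlinarith)
    (by
      intro k x hx
      have hdiff : ∀ y ∈ cell (generation σ (k₀ + (k + 1)))
          (cellIndex (generation σ (k₀ + (k + 1))) x),
          P (k₀ + (k + 1)) y - P (k₀ + k) y = MvPolynomial.eval y
            (Q (k₀ + (k + 1)) (cellIndex (generation σ (k₀ + (k + 1))) x) -
              Q (k₀ + k) (cellIndex (generation σ (k₀ + k)) x)) := by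
        intro y hy
        have h1 := (mem_cell_iff.1 hy).2
        have h2 : cellIndex (generation σ (k₀ + k)) y = cellIndex (generation σ (k₀ + k)) x := by
          rw [← ancestor_cellIndex (hanc k (k + 1) (by omega)) y, h1,
            ancestor_cellIndex (hanc k (k + 1) (by omega))]
        simp only [P, map_sub, h1, h2]
      have hxc := mem_cell_cellIndex (generation σ (k₀ + (k + 1))) (mem_unitCube_iff.1 hx).1
      have hcellmeas : MeasurableSet (cell (generation σ (k₀ + (k + 1)))
          (cellIndex (generation σ (k₀ + (k + 1))) x)) :=
        measurableSet_of_mem_dyadicRectangles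
          (cell_mem_dyadicRectangles fun l => cellIndex_lt hx l)
      rw [setLIntegral_cellIndex_fiber hx, hdiff x hxc,
        setLIntegral_congr_fun (g := fun y => ‖MvPolynomial.eval y
            (Q (k₀ + (k + 1)) (cellIndex (generation σ (k₀ + (k + 1))) x) -
              Q (k₀ + k) (cellIndex (generation σ (k₀ + k)) x))‖ₑ ^ p.toReal) hcellmeas
          (fun y hy => by simp only [hdiff y hy])]
      refine (hNik _ (sub_mem_polys (hQ _ _) (hQ _ _)) _ _ x hxc).trans ?_
      gcongr
      exact hgen (k₀ + (k + 1)))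
    (by
      have h0 : Tendsto (fun k => n * ρ ^ k) atTop (𝓝 0) := by
        rw [← mul_zero n]
        exact (tendsto_pow_atTop_nhds_zero_of_lt_one hρ0.le hρ1).const_mul _
      exact eventually_atTop.1 (h0.eventually_lt_const one_pos))
    (sum_add_one_mul_geometric_le hρ0 hρ1 hn.le)
  have hFD : F.card ≤ D := by
    have h1 : ((positions (generation σ (k₀ + 0))).card : ℝ) ≤ max n 1 := by
      rw [card_positions]
      push_cast
      exact (hgen k₀).trans hk₀
    have h2 : ((2 ^ d : ℕ) : ℝ) * (n / (1 - ρ) ^ 2) ≤ (D : ℝ) / 2 := by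
      have h3 : n ≤ (1 - ρ) ^ 2 / (2 * 2 ^ d) * D := by
        simp only [n]
        gcongr
      push_cast
      calc (2 : ℝ) ^ d * (n / (1 - ρ) ^ 2)
          ≤ 2 ^ d * ((1 - ρ) ^ 2 / (2 * 2 ^ d) * D / (1 - ρ) ^ 2) := by gcongr
        _ = (D : ℝ) / 2 := by field_simp
    -- Strictness matters: it gives `F.card < D + 1`, hence `F.card ≤ D` for integers, including `D
    -- = 1`.
    have h4 : max n 1 < (D : ℝ) / 2 + 1 := by
      have : n ≤ 1 / 2 * D := by
        simp only [n]
        gcongr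
      exact max_lt (by linarith) (by linarith)
    have h5 : (F.card : ℝ) < (D + 1 : ℕ) := by
      push_cast
      linarith
    exact Nat.lt_succ_iff.1 (by exact_mod_cast h5)
  obtain ⟨m, hm, ht⟩ := exists_partition_of_level hd r (fun k => generation σ (k₀ + k)) hlev hF
    (Q := fun k => Q (k₀ + k)) (fun k => hQ (k₀ + k)) hFD
  refine ⟨m, hm, _, ht, herr.trans ?_⟩
  -- the sum of the errors
  have hterm : ∀ k : ℕ, c * R * β ^ (k₀ + k) * (A * y ^ (k₀ + k + 1) / (n * ρ ^ k)) ^ δ =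
      c * R * β ^ k₀ * (A * y * y ^ k₀ / n) ^ δ * θ ^ k := by
    intro k
    have h1 : A * y ^ (k₀ + k + 1) / (n * ρ ^ k) = A * y * y ^ k₀ / n * (y / ρ) ^ k := by
      rw [div_pow]
      field_simp
      ring
    have h2 : β * (y / ρ) ^ δ = θ := by
      have : y / ρ = y ^ (1 + ε) := by
        simp only [ρ]
        rw [Real.rpow_neg hy0.le, div_inv_eq_mul, Real.rpow_add hy0, Real.rpow_one]
      rw [this, ← Real.rpow_mul hy0.le]
      simp only [β, θ]
      rw [← Real.rpow_add hy0]
      congr 1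
      ring
    rw [h1, Real.mul_rpow (by positivity) (by positivity), ← h2, mul_pow, pow_add,
      ← Real.rpow_pow_comm (by positivity)]
    ring
  rw [hδ]
  simp only [hterm]
  rw [← ENNReal.ofReal_tsum_of_nonneg (fun k => by positivity)
    ((summable_geometric_of_lt_one hθ0.le hθ1).mul_left _), tsum_mul_left,
    tsum_geometric_of_lt_one hθ0.le hθ1]
  refine ENNReal.ofReal_le_ofReal ?_
  have hβk : β ^ k₀ ≤ (c₁ / y) ^ (-α) * (D : ℝ) ^ (-α) := by
    rw [← Real.mul_rpow (by positivity) hD0.le]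
    simp only [β]
    rw [Real.rpow_pow_comm hy0.le]
    exact Real.rpow_le_rpow_of_nonpos (by positivity) hyk' (by linarith)
  have hWN : (A * y * y ^ k₀ / n) ^ δ ≤ (A * y / c₁) ^ δ := by
    refine Real.rpow_le_rpow (by positivity) ?_ hδ0
    simp only [n]
    rw [div_le_div_iff₀ (by positivity) hc₁]
    calc A * y * y ^ k₀ * c₁ ≤ A * y * D * c₁ := by gcongr
      _ = A * y * (c₁ * D) := by ring
  calc c * R * β ^ k₀ * (A * y * y ^ k₀ / n) ^ δ * (1 - θ)⁻¹
      ≤ c * R * ((c₁ / y) ^ (-α) * (D : ℝ) ^ (-α)) * (A * y / c₁) ^ δ * (1 - θ)⁻¹ := by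
        gcongr
    _ = _ := by
        rw [div_eq_mul_inv _ (1 - θ)]
        ring

end DyadicApprox

end

theorem mainTheorem8 (d : ℕ) (hd : 1 ≤ d) (r : Fin d → ℕ) (σ : Fin d → ℝ)
    (hσ : ∀ l, 0 < σ l ∧ σ l < (r l : ℝ) + 1)
    (p q : ℝ≥0∞) (hp0 : 0 < p) (hp : p < ∞) (hq : 1 ≤ q)
    (hH : max (p⁻¹.toReal - q⁻¹.toReal) 0 < DyadicApprox.harmonicMean σ / d) :
    ∃ C : ℝ, 0 < C ∧
      ∀ p' : ℝ≥0∞, 0 < p' → (1 < p → p < q → p' ≤ p) →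
      ∀ R : ℝ, 0 < R → ∀ D : ℕ, 1 ≤ D →
        (⨆ s ∈ DyadicApprox.smoothnessClass r σ p p' R,
          ⨅ t ∈ ⋃ m ∈ DyadicApprox.dyadicPartitions d D,
              DyadicApprox.piecewisePolys r (m : Set (Set (Fin d → ℝ))),
            DyadicApprox.cubeNorm q (s - t)) ≤
          ENNReal.ofReal (C * R * (D : ℝ) ^ (-(DyadicApprox.harmonicMean σ / d))) := by
  -- If `q < p`, approximate in `L_p` instead, which dominates `L_q` on the unit cube; the positive
  -- part in `hH` covers both cases.
  have hpm : (p⁻¹.toReal - (max p q)⁻¹.toReal) < DyadicApprox.harmonicMean σ / d := by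
    rcases le_total p q with h | h
    · rw [max_eq_right h]
      exact (le_max_left _ _).trans_lt hH
    · rw [max_eq_left h, sub_self]
      exact (le_max_right _ _).trans_lt hH
  obtain ⟨C, hC, h⟩ := DyadicApprox.exists_adaptive_approx hd r (fun l => (hσ l).1) hp0 hp
    (le_max_left p q) (hq.trans (le_max_right p q)) hpm
  refine ⟨C, hC, fun p' hp' _ R hR D hD => iSup₂_le fun s hs => ?_⟩
  obtain ⟨m, hm, t, ht, hst⟩ := h s hs.1.1 R hR
    (DyadicApprox.mul_approxError_le_of_smoothness_le hp' hs.2) D hD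
  refine (iInf₂_le t (Set.mem_iUnion₂.2 ⟨m, hm, ht⟩)).trans (le_trans ?_ hst)
  exact eLpNorm_le_eLpNorm_of_exponent_le (le_max_right p q)
    (hs.1.1.sub (DyadicApprox.aemeasurable_of_mem_piecewisePolys hm ht).aestronglyMeasurable)
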